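/- Consider the (non-restricted, full-duplex, reciprocal) Gaussian Y-channel: users $1,2,3$ and a relay, gains $h_1,h_2,h_3\in\mathbb{R}$ with $h_1^2\ge h_2^2\ge h_3^2$, and power $P\ge 0$. For each ordered pair of distinct users $(j,k)$, user $j$ has a message $m_{jk}$ for user $k$, uniform on a set of $\lceil 2^{nR_{jk}}\rceil$ elements, $R_{jk}\ge0$; the six messages are independent. At times $i=1,\dots,n$ the relay receives $y_{ri}=h_1x_{1i}+h_2x_{2i}+h_3x_{3i}+z_{ri}$ and user $j$ receives $y_{ji}=h_jx_{ri}+z_{ji}$, all noise samples being independent $\mathcal N(0,1)$. User $j$ sends $x_{ji}=f_{ji}(m_{jk},m_{jl},y_j^{i-1})$, the relay sends $x_{ri}=f_{ri}(y_r^{i-1})$, every transmitter satisfies $\frac1n\sum_{i=1}^n\mathbb{E}[X_i^2]\le P$, and user $j$ estimates $(m_{kj},m_{lj})$ (with $\{j,k,l\}=\{1,2,3\}$) from $(y_j^n,m_{jk},m_{jl})$. A tuple $(R_{jk})$ is achievable if there are codes of these rates, one for each length $n$, whose average probability that some user decodes incorrectly tends to $0$ as $n\to\infty$; the sum-capacity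 $C_N$ is the supremum of $\sum_{j\ne k}R_{jk}$ over achievable tuples. A complete decode-and-forward (CDF) scheme is a code of the following form. Each message is split injectively into $B$ submessages, and there are $B+1$ time blocks of equal length, with total length at most $n$. In each of the first $B$ blocks every user sends a codeword that depends only on its own submessages for that block; at the end of the block the relay decodes all six submessages from the signal it received in that block, and in the next block it sends a codeword that depends only on this decoded six-tuple. Nothing else is sent. A sum-rate is achieved by CDF if it is at most the supremum of the sum-rates $\sum_{j\ne k}R_{jk}$ of tuples for which there are CDF schemes, one for each sufficiently large $n$, satisfying the power constraints, such that the average probabilities of error, both at the users and in the decoding at the relay, tend to $0$. Let $C(x)=\frac12\log_2(1+x)$ and $$\underline{C}_{1}=\min\Big\{\tfrac12\big[C(\min\{h_1^2,h_2^2+h_3^2\}P)+C(h_2^2P)+C(h_3^2P)\big],\ C\big((h_1^2+h_2^2+h_3^2)P\big),\ 2C(h_3^2P)\Big\}.$$ Theorem. For all $P\ge0$, $C_N\ge\underline{C}_1$; moreover the sum-rate $\underline{C}_1$ is achieved by CDF. If $h_3\ne0$, this bound gives one degree of freedom: $$\lim_{P\to\infty}\frac{\underline{C}_1}{\frac12\log_2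 P}=1.$$ -/

import Mathlib

open MeasureTheory ProbabilityTheory Filter Topology
open scoped NNReal ENNReal

namespace YChannel

/-- Ordered pairs `(j, k)` of distinct users. The users `1, 2, 3` are the elements `0, 1, 2` of
`Fin 3`; the pair `(j, k)` indexes the message `m_{jk}` sent by user `j` to user `k`. -/
abbrev Pair : Type := {p : Fin 3 × Fin 3 // p.1 ≠ p.2}

/-- Tuples of all six messages, when `m_p` takes `M p` values. -/
abbrev Msgs (M : Pair → ℕ) : Type := (p : Pair) → Fin (M p)

/-- Pairs of messages sent by user `j`. -/
abbrev Sent (M : Pair → ℕ) (j : Fin 3) : Type := (p : {p : Pair // p.1.1 = j}) → Fin (M p.1)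

/-- Pairs of messages intended for user `j`. -/
abbrev Wanted (M : Pair → ℕ) (j : Fin 3) : Type := (p : {p : Pair // p.1.2 = j}) → Fin (M p.1)

/-- The messages of user `j`. -/
def sent {M : Pair → ℕ} (m : Msgs M) (j : Fin 3) : Sent M j := fun p => m p.1

/-- The messages that user `j` wants. -/
def wanted {M : Pair → ℕ} (m : Msgs M) (j : Fin 3) : Wanted M j := fun p => m p.1

/-- A (non-restricted) code with `n` channel uses. The `i`-th symbol of a node may depend on the
symbols received at that node strictly before time `i`. -/
structure Code (M : Pair → ℕ) (n : ℕ) where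
  /-- The encoding functions `f_{ji}` of the users. -/
  userEnc : (j : Fin 3) → (i : Fin n) → Sent M j → (Fin i → ℝ) → ℝ
  /-- The encoding functions `f_{ri}` of the relay. -/
  relayEnc : (i : Fin n) → (Fin i → ℝ) → ℝ
  /-- The decoding functions `g_j` of the users. -/
  dec : (j : Fin 3) → (Fin n → ℝ) → Sent M j → Wanted M j
  measurable_userEnc : ∀ j i w, Measurable (userEnc j i w)
  measurable_relayEnc : ∀ i, Measurable (relayEnc i)
  measurable_dec : ∀ j w, Measurable fun y => dec j y w

/-- Noise realizations over `n` channel uses: at the relay (first component) and at the users. -/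
abbrev Noise (n : ℕ) : Type := (Fin n → ℝ) × (Fin 3 → Fin n → ℝ)

/-- All noise samples are independent and standard normal. -/
noncomputable def noiseLaw (n : ℕ) : Measure (Noise n) :=
  (Measure.pi fun _ => gaussianReal 0 1).prod
    (Measure.pi fun _ => Measure.pi fun _ => gaussianReal 0 1)

section Signals

variable {M : Pair → ℕ} {n : ℕ} (h : Fin 3 → ℝ) (c : Code M n) (m : Msgs M) (z : Noise n)

/-- The first `t` symbols received at the relay and at the users. At each time, the relay receives
`y_r = h₁ x₁ + h₂ x₂ + h₃ x₃ + z_r` and user `j` receives `y_j = h_j x_r + z_j`. -/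
noncomputable def received : (t : ℕ) → t ≤ n → (Fin t → ℝ) × (Fin 3 → Fin t → ℝ)
  | 0, _ => (Fin.elim0, fun _ => Fin.elim0)
  | t + 1, ht =>
    let y := received t (Nat.le_of_succ_le ht)
    (Fin.snoc (α := fun _ => ℝ) y.1
      (∑ j, h j * c.userEnc j ⟨t, ht⟩ (sent m j) (y.2 j) + z.1 ⟨t, ht⟩),
     fun j => Fin.snoc (α := fun _ => ℝ) (y.2 j) (h j * c.relayEnc ⟨t, ht⟩ y.1 + z.2 j ⟨t, ht⟩))

/-- The `i`-th symbol `x_{ji}` sent by user `j`. -/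
noncomputable def userInput (j : Fin 3) (i : Fin n) : ℝ :=
  c.userEnc j i (sent m j) ((received h c m z i i.2.le).2 j)

/-- The `i`-th symbol `x_{ri}` sent by the relay. -/
noncomputable def relayInput (i : Fin n) : ℝ :=
  c.relayEnc i (received h c m z i i.2.le).1

/-- Some user does not recover both messages intended for it. -/
def DecodingError : Prop :=
  ∃ j, c.dec j ((received h c m z n le_rfl).2 j) (sent m j) ≠ wanted m j

end Signals

/-- Expectation over independent uniform messages and the noise. -/
noncomputable def expect {M : Pair → ℕ} {n : ℕ} (X : Msgs M → Noise n → ℝ≥0∞) : ℝ≥0∞ :=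
  (∑ m, ∫⁻ z, X m z ∂noiseLaw n) / (Fintype.card (Msgs M) : ℝ≥0∞)

/-- Probability over independent uniform messages and the noise. -/
noncomputable def prob {M : Pair → ℕ} {n : ℕ} (E : Msgs M → Noise n → Prop) : ℝ≥0∞ :=
  (∑ m, noiseLaw n {z | E m z}) / (Fintype.card (Msgs M) : ℝ≥0∞)

/-- The average power constraint `(1/n) ∑ᵢ E[Xᵢ²] ≤ P` at every user and at the relay. -/
def PowerConstraint {M : Pair → ℕ} {n : ℕ} (h : Fin 3 → ℝ) (P : ℝ) (c : Code M n) : Prop :=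
  (∀ j, (∑ i, expect fun m z => ENNReal.ofReal (userInput h c m z j i ^ 2)) / (n : ℝ≥0∞)
      ≤ ENNReal.ofReal P) ∧
  (∑ i, expect fun m z => ENNReal.ofReal (relayInput h c m z i ^ 2)) / (n : ℝ≥0∞)
      ≤ ENNReal.ofReal P

/-- The number of values of each message at rate `R` (bits per channel use) and length `n`. -/
noncomputable def numMsgs (R : Pair → ℝ≥0) (n : ℕ) (p : Pair) : ℕ :=
  ⌈(2 : ℝ) ^ ((n : ℝ) * (R p : ℝ))⌉₊

/-- There are codes of rate tuple `R`, one for each length, that satisfy the power constraint and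
whose average error probability tends to zero. -/
def Achievable (h : Fin 3 → ℝ) (P : ℝ) (R : Pair → ℝ≥0) : Prop :=
  ∃ c : (n : ℕ) → Code (numMsgs R n) n,
    (∀ n, PowerConstraint h P (c n)) ∧
    Tendsto (fun n => prob (DecodingError h (c n))) atTop (𝓝 0)

/-- The sum-capacity `C_N` of the non-restricted Y-channel. -/
noncomputable def sumCapacity (h : Fin 3 → ℝ) (P : ℝ) : ℝ≥0∞ :=
  ⨆ (R : Pair → ℝ≥0) (_ : Achievable h P R), ∑ p, (R p : ℝ≥0∞)

/-- A complete decode-and-forward scheme. Each message is split into `B` submessages (`K p` possible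
values each) and time into blocks of length `ℓ`. In block `b < B`, each user sends a codeword
chosen by its own `b`-th submessages alone. After block `b` the relay decodes all six `b`-th
submessages from what it received in that block, and in block `b + 1` it sends a codeword chosen by
the decoded six-tuple. Nothing is sent at other times. -/
structure CDFCode (M : Pair → ℕ) (n : ℕ) where
  /-- Block length. -/
  ℓ : ℕ
  /-- Number of message blocks. -/
  B : ℕ
  ℓ_pos : 0 < ℓ
  fits : (B + 1) * ℓ ≤ n
  /-- Number of values of a submessage. -/
  K : Pair → ℕ
  split : (p : Pair) → Fin (M p) → Fin B → Fin (K p)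
  split_injective : ∀ p, Function.Injective (split p)
  /-- Codebooks of the users. -/
  userBook : (j : Fin 3) → Sent K j → Fin ℓ → ℝ
  /-- Decoder of the relay, from one received block. -/
  relayDec : (Fin ℓ → ℝ) → Msgs K
  /-- Codebook of the relay. -/
  relayBook : Msgs K → Fin ℓ → ℝ
  /-- Decoding functions of the users. -/
  dec : (j : Fin 3) → (Fin n → ℝ) → Sent M j → Wanted M j
  measurable_relayDec : Measurable relayDec
  measurable_dec : ∀ j w, Measurable fun y => dec j y w

namespace CDFCode

variable {M : Pair → ℕ} {n : ℕ} (s : CDFCode M n)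

theorem block_lt {ℓ i : ℕ} (hq : 1 ≤ i / ℓ) (k : Fin ℓ) : (i / ℓ - 1) * ℓ + k < i := by
  have h1 : (i / ℓ - 1) * ℓ + ℓ = i / ℓ * ℓ := by
    rw [← Nat.succ_mul, Nat.succ_eq_add_one, Nat.sub_add_cancel hq]
  have h2 := Nat.div_mul_le_self i ℓ
  have h3 := k.2
  omega

theorem index_lt (b : Fin s.B) (k : Fin s.ℓ) : (b : ℕ) * s.ℓ + k < n := by
  have h1 : ((b : ℕ) + 1) * s.ℓ ≤ (s.B + 1) * s.ℓ := Nat.mul_le_mul_right _ (by omega)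
  have h2 : ((b : ℕ) + 1) * s.ℓ = b * s.ℓ + s.ℓ := Nat.succ_mul _ _
  have h3 := s.fits
  have h4 := k.2
  omega

/-- The code for the Y-channel given by the scheme. Time `i` is position `i % ℓ` of block
`i / ℓ`. -/
noncomputable def toCode : Code M n where
  userEnc j i w _ :=
    if hb : (i : ℕ) / s.ℓ < s.B then
      s.userBook j (fun p => s.split p.1 (w p) ⟨i / s.ℓ, hb⟩) ⟨i % s.ℓ, Nat.mod_lt _ s.ℓ_pos⟩
    else 0
  relayEnc i y :=
    if hb : 1 ≤ (i : ℕ) / s.ℓ ∧ (i : ℕ) / s.ℓ ≤ s.B then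
      s.relayBook (s.relayDec fun k => y ⟨(i / s.ℓ - 1) * s.ℓ + k, block_lt hb.1 k⟩)
        ⟨i % s.ℓ, Nat.mod_lt _ s.ℓ_pos⟩
    else 0
  dec := s.dec
  measurable_userEnc _ _ _ := measurable_const
  measurable_relayEnc i := by
    by_cases hb : 1 ≤ (i : ℕ) / s.ℓ ∧ (i : ℕ) / s.ℓ ≤ s.B
    · simp only [dif_pos hb]
      exact (measurable_of_finite fun w => s.relayBook w ⟨i % s.ℓ, Nat.mod_lt _ s.ℓ_pos⟩).comp
        (s.measurable_relayDec.comp (measurable_pi_lambda _ fun k => measurable_pi_apply _))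
    · simp only [dif_neg hb]
      exact measurable_const
  measurable_dec := s.measurable_dec

/-- The relay does not decode all submessages of all blocks correctly. -/
def RelayError (h : Fin 3 → ℝ) (m : Msgs M) (z : Noise n) : Prop :=
  ∃ b : Fin s.B,
    s.relayDec (fun k => (received h s.toCode m z n le_rfl).1 ⟨b * s.ℓ + k, s.index_lt b k⟩)
      ≠ fun p => s.split p (m p) b

end CDFCode

/-- There are complete decode-and-forward schemes of rate tuple `R`, one for each length from some
`N` on, that satisfy the power constraint and for which the average error probabilities of the
users and of the relay tend to zero. -/
def CDFAchievable (h : Fin 3 → ℝ) (P : ℝ) (R : Pair → ℝ≥0) : Prop :=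
  ∃ (N : ℕ) (s : (i : ℕ) → CDFCode (numMsgs R (N + i)) (N + i)),
    (∀ i, PowerConstraint h P (s i).toCode) ∧
    Tendsto (fun i => prob (DecodingError h (s i).toCode)) atTop (𝓝 0) ∧
    Tendsto (fun i => prob ((s i).RelayError h)) atTop (𝓝 0)

/-- The supremum of the sum-rates achieved by complete decode-and-forward. -/
noncomputable def cdfSumRate (h : Fin 3 → ℝ) (P : ℝ) : ℝ≥0∞ :=
  ⨆ (R : Pair → ℝ≥0) (_ : CDFAchievable h P R), ∑ p, (R p : ℝ≥0∞)

/-- `C(x) = ½ log₂ (1 + x)`. -/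
noncomputable def gaussC (x : ℝ) : ℝ := 1 / 2 * Real.logb 2 (1 + x)

/-- The lower bound `C̲₁`. -/
noncomputable def cdfBound (h₁ h₂ h₃ P : ℝ) : ℝ :=
  min (1 / 2 * (gaussC (min (h₁ ^ 2) (h₂ ^ 2 + h₃ ^ 2) * P) + gaussC (h₂ ^ 2 * P)
      + gaussC (h₃ ^ 2 * P)))
    (min (gaussC ((h₁ ^ 2 + h₂ ^ 2 + h₃ ^ 2) * P)) (2 * gaussC (h₃ ^ 2 * P)))

end YChannel

/-! The relay decodes everything and re-encodes it, so the channel becomes a multiple-access uplink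
followed by a broadcast downlink. If user `j` has total rate `r j`, it suffices that `∑_{j∈S} r j <
C(P ∑_{j∈S} h j²)` for every nonempty `S` (uplink) and `∑_{j≠i} r j < C(P h i²)` for every `i`
(downlink, where user `i` knows its own messages); this is `cdfAchievable_of_lt`. The bound is then
a small linear program, `exists_rates`: `A₁ = C(min{h₁², h₂²+h₃²} P)` handles the pair of users 2, 3
on the uplink and the downlink to user 1 at once.

Both phases use one random-coding argument. Codewords are i.i.d. Gaussian of variance `q < P`, and a
message tuple is accepted if the residual energy is at most `ℓ(1+ε)`. For a competitor differing
from the truth in `S`, the residual is `Y - V`, where `Y` contains the noise and the true codewords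
of `S`, and `V` the competing ones, independent of `Y`. With `τ = q ∑_{j∈S} g j²`, where the `g j`
are the gains, a Chernoff bound (`competitor_le`) gives acceptance probability at most `(exp ε /
√(1+τ))^ℓ`, apart from the event that `Y` has atypically small energy. A union bound over
competitors thus succeeds below rate `½ log₂(1+τ)`, up to `ε`. `decoding_error_le` collects the
error events, `exists_codebook` derandomizes, `exists_cdfCode` assembles the blocks. -/

namespace YChannel

/-! ### Exponential moments of Gaussian quadratic forms and Chernoff bounds. -/

/-- The Chernoff base `√a exp((1 - a) / 2)` for the deviation of a normalized sum of squares of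
standard Gaussians from `1` to `a`. -/
noncomputable def chernoffBase (a : ℝ) : ℝ := √a * Real.exp ((1 - a) / 2)

theorem chernoffBase_nonneg (a : ℝ) : 0 ≤ chernoffBase a := by unfold chernoffBase; positivity

theorem chernoffBase_lt_one {a : ℝ} (ha1 : a ≠ 1) : chernoffBase a < 1 := by
  have h1 : a < Real.exp (a - 1) := by
    have := Real.add_one_lt_exp (x := a - 1) (by intro h; apply ha1; linarith)
    linarith
  have h2 : √a < Real.exp ((a - 1) / 2) := by
    rw [Real.sqrt_lt' (Real.exp_pos _), ← Real.exp_nat_mul]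
    convert h1 using 2
    push_cast; ring
  calc chernoffBase a < Real.exp ((a - 1) / 2) * Real.exp ((1 - a) / 2) :=
        mul_lt_mul_of_pos_right h2 (Real.exp_pos _)
    _ = 1 := by rw [← Real.exp_add, ← Real.exp_zero]; ring_nf

/-- Exponential tilting: a weight that turns one Gaussian density into a multiple of another has
that multiple as its mean. The two integrals below follow by completing the square. -/
theorem lintegral_gaussianReal_of_mul_pdf {v v' : ℝ≥0} (hv : v ≠ 0) (hv' : v' ≠ 0) (m m' c : ℝ)
    (hc : 0 ≤ c) {f : ℝ → ℝ} (hf : Measurable f)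
    (hfm : ∀ x, gaussianPDFReal m v x * f x = c * gaussianPDFReal m' v' x) :
    ∫⁻ x, ENNReal.ofReal (f x) ∂gaussianReal m v = ENNReal.ofReal c := by
  rw [gaussianReal_of_var_ne_zero _ hv,
    lintegral_withDensity_eq_lintegral_mul _ (measurable_gaussianPDF _ _) hf.ennreal_ofReal]
  have : ∀ x, (gaussianPDF m v * fun x => ENNReal.ofReal (f x)) x
      = ENNReal.ofReal c * gaussianPDF m' v' x := fun x => by
    simp only [Pi.mul_apply, gaussianPDF]
    rw [← ENNReal.ofReal_mul (gaussianPDFReal_nonneg _ _ _), hfm, ENNReal.ofReal_mul hc]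
  simp_rw [this]
  rw [lintegral_const_mul _ (measurable_gaussianPDF _ _), lintegral_gaussianPDF_eq_one _ hv',
    mul_one]

/-- The exponent `(1 - a⁻¹) / 2` is the optimal Chernoff parameter: the tilt changes the variance
from `v` to `a v`. It is positive for `a > 1` and negative for `a < 1`, so one formula serves both
tails. -/
theorem lintegral_exp_sq_gaussianReal {v : ℝ≥0} (hv : v ≠ 0) {a : ℝ} (ha : 0 < a) :
    ∫⁻ x, ENNReal.ofReal (Real.exp ((1 - a⁻¹) / 2 * (x ^ 2 / v - a))) ∂gaussianReal 0 v
      = ENNReal.ofReal (chernoffBase a) := by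
  have hv0 : (0 : ℝ) < v := by positivity
  refine lintegral_gaussianReal_of_mul_pdf hv (v' := NNReal.mk a ha.le * v)
    (mul_ne_zero (fun h => ha.ne' (congrArg NNReal.toReal h)) hv) 0 0 _ (chernoffBase_nonneg a)
    (by fun_prop) fun x => ?_
  have h1 : ((NNReal.mk a ha.le * v : ℝ≥0) : ℝ) = a * v := rfl
  simp only [gaussianPDFReal, chernoffBase, h1]
  have h2 : √(2 * Real.pi * (a * v)) = √a * √(2 * Real.pi * v) := by
    rw [← Real.sqrt_mul ha.le]; ring_nf
  rw [h2, mul_inv, mul_assoc, ← Real.exp_add]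
  have h3 : √a ≠ 0 := (Real.sqrt_pos.2 ha).ne'
  rw [show √a * Real.exp ((1 - a) / 2) * ((√a)⁻¹ * (√(2 * Real.pi * v))⁻¹
      * Real.exp (-(x - 0) ^ 2 / (2 * (a * v))))
    = (√a * (√a)⁻¹) * ((√(2 * Real.pi * v))⁻¹ * (Real.exp ((1 - a) / 2)
      * Real.exp (-(x - 0) ^ 2 / (2 * (a * v))))) by ring,
    mul_inv_cancel₀ h3, one_mul, ← Real.exp_add]
  congr 2
  field_simp
  ring

/-- The tilted law is the posterior of `v` given `v + N(0,1) = u`. The term `u² / (1 + τ)` is chosen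
so that the result does not depend on `u`. -/
theorem lintegral_exp_sub_sq_gaussianReal {τ : ℝ≥0} (hτ : τ ≠ 0) (u : ℝ) :
    ∫⁻ v, ENNReal.ofReal (Real.exp ((u ^ 2 / (1 + τ) - (u - v) ^ 2) / 2)) ∂gaussianReal 0 τ
      = ENNReal.ofReal (√(1 + τ))⁻¹ := by
  have hv0 : (0 : ℝ) < τ := by positivity
  have h1τ : (0 : ℝ) < 1 + τ := by positivity
  refine lintegral_gaussianReal_of_mul_pdf hτ (v' := τ / (1 + τ))
    (div_ne_zero hτ (by positivity)) 0 (u * τ / (1 + τ)) _ (by positivity) (by fun_prop)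
    fun x => ?_
  simp only [gaussianPDFReal, NNReal.coe_div, NNReal.coe_add, NNReal.coe_one]
  have h2 : √(2 * Real.pi * (τ / (1 + τ))) = √(2 * Real.pi * τ) * (√(1 + (τ : ℝ)))⁻¹ := by
    rw [← Real.sqrt_inv, ← Real.sqrt_mul (by positivity)]; ring_nf
  have h3 : √(1 + (τ : ℝ)) ≠ 0 := (Real.sqrt_pos.2 h1τ).ne'
  rw [h2, mul_inv, inv_inv, mul_assoc, ← Real.exp_add]
  rw [show (√(1 + (τ : ℝ)))⁻¹ * ((√(2 * Real.pi * τ))⁻¹ * √(1 + (τ : ℝ))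
      * Real.exp (-(x - u * τ / (1 + τ)) ^ 2 / (2 * (τ / (1 + τ)))))
    = ((√(1 + (τ : ℝ)))⁻¹ * √(1 + (τ : ℝ))) * ((√(2 * Real.pi * τ))⁻¹
      * Real.exp (-(x - u * τ / (1 + τ)) ^ 2 / (2 * (τ / (1 + τ))))) by ring,
    inv_mul_cancel₀ h3, one_mul]
  congr 2
  field_simp
  ring

/-- Chernoff bound for sums of independent copies. -/
theorem pi_sum_nonneg_le {α ι : Type*} [MeasurableSpace α] [Fintype ι] (μ : Measure α)
    [IsProbabilityMeasure μ] {f : α → ℝ} (hf : Measurable f) :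
    (Measure.pi fun _ : ι => μ) {x | 0 ≤ ∑ k, f (x k)}
      ≤ (∫⁻ x, ENNReal.ofReal (Real.exp (f x)) ∂μ) ^ Fintype.card ι := by
  have hm : Measurable fun x => ENNReal.ofReal (Real.exp (f x)) := by fun_prop
  have hind : iIndepFun (fun (k : ι) (x : ι → α) => ENNReal.ofReal (Real.exp (f (x k))))
      (Measure.pi fun _ : ι => μ) :=
    iIndepFun_pi (X := fun _ x => ENNReal.ofReal (Real.exp (f x))) fun _ => hm.aemeasurable
  have h1 := lintegral_prod_eq_prod_lintegral_of_indepFun Finset.univ _ hind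
    (fun k => hm.comp (measurable_pi_apply k))
  have h2 : ∀ k : ι, ∫⁻ x, ENNReal.ofReal (Real.exp (f (x k))) ∂(Measure.pi fun _ : ι => μ)
      = ∫⁻ x, ENNReal.ofReal (Real.exp (f x)) ∂μ := fun k =>
    (measurePreserving_eval (fun _ : ι => μ) k).lintegral_comp hm
  simp_rw [h2, Finset.prod_const, Finset.card_univ] at h1
  rw [← h1]
  refine le_trans (le_of_eq ?_) (meas_ge_le_lintegral_div (ε := 1) ?_ one_ne_zero
    ENNReal.one_ne_top |>.trans_eq (div_one _))
  · congr 1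
    ext x
    simp only [Set.mem_ofPred_eq, ← ENNReal.ofReal_prod_of_nonneg fun k _ => (Real.exp_pos _).le,
      ← Real.exp_sum, ENNReal.one_le_ofReal, Real.one_le_exp_iff]
  · exact (Finset.measurable_prod _ fun k _ => hm.comp (measurable_pi_apply k)).aemeasurable

theorem pi_prod_pi_sum_nonneg_le {α β ι : Type*} [MeasurableSpace α] [MeasurableSpace β]
    [Fintype ι] (μ : Measure α) (ν : Measure β) [IsProbabilityMeasure μ] [IsProbabilityMeasure ν]
    {f : α → β → ℝ} (hf : Measurable fun p : α × β => f p.1 p.2) :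
    ((Measure.pi fun _ : ι => μ).prod (Measure.pi fun _ : ι => ν))
        {x | 0 ≤ ∑ k, f (x.1 k) (x.2 k)}
      ≤ (∫⁻ x, ∫⁻ z, ENNReal.ofReal (Real.exp (f x z)) ∂ν ∂μ) ^ Fintype.card ι := by
  have h1 := measurePreserving_arrowProdEquivProdArrow α β ι (fun _ => μ) (fun _ => ν)
  have hs : MeasurableSet {x : (ι → α) × (ι → β) | 0 ≤ ∑ k, f (x.1 k) (x.2 k)} := by
    refine measurableSet_le measurable_const (Finset.measurable_sum _ fun k _ => ?_)
    exact hf.comp (f := fun x : (ι → α) × (ι → β) => (x.1 k, x.2 k)) (by fun_prop)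
  rw [← h1.measure_preimage hs.nullMeasurableSet]
  refine (pi_sum_nonneg_le (ι := ι) (μ.prod ν) hf).trans_eq ?_
  rw [lintegral_prod _ (by fun_prop)]

/-! ### Laws of superposed Gaussian codewords at a single time. -/

section LinearCombinations

variable {C : Type*} [Fintype C]

theorem iIndepFun_coord (q : ℝ≥0) :
    iIndepFun (fun (c : C) (x : C → ℝ) => x c) (Measure.pi fun _ : C => gaussianReal 0 q) :=
  iIndepFun_pi (X := fun _ x => x) fun _ => aemeasurable_id

theorem map_sum_mul_pi_gaussianReal (q : ℝ≥0) (s : Finset C) (a : C → ℝ) (v : ℝ≥0)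
    (hv : (v : ℝ) = (∑ c ∈ s, a c ^ 2) * q) :
    (Measure.pi fun _ : C => gaussianReal 0 q).map (fun x => ∑ c ∈ s, a c * x c)
      = gaussianReal 0 v := by
  classical
  induction s using Finset.induction_on generalizing v with
  | empty =>
    have : v = 0 := by rw [← NNReal.coe_inj]; simpa using hv
    simp [this, Measure.map_const]
  | insert c s hc ih =>
    set w : ℝ≥0 := NNReal.mk ((∑ c ∈ s, a c ^ 2) * q) (by positivity) with hw
    have hind : iIndepFun (fun (c : C) (x : C → ℝ) => a c * x c)
        (Measure.pi fun _ : C => gaussianReal 0 q) :=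
      iIndepFun_pi (X := fun c x => a c * x) fun _ => by fun_prop
    have h1 := hind.indepFun_finsetSum_of_notMem (fun c => by fun_prop) hc
    have h2 : (Measure.pi fun _ : C => gaussianReal 0 q).map (fun x => a c * x c)
        = gaussianReal 0 (NNReal.mk (a c ^ 2) (sq_nonneg _) * q) := by
      have h3 := gaussianReal_map_const_mul (μ := 0) (v := q) (a c)
      rw [mul_zero] at h3
      have h7 : (Measure.pi fun _ : C => gaussianReal 0 q).map (fun x => x c) = gaussianReal 0 q :=
        (measurePreserving_eval (fun _ : C => gaussianReal 0 q) c).map_eq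
      rw [← h3]
      conv_rhs => rw [← h7]
      exact (Measure.map_map (by fun_prop) (by fun_prop)).symm
    have h4 : (Measure.pi fun _ : C => gaussianReal 0 q).map (∑ c ∈ s, fun x => a c * x c)
        = gaussianReal 0 w := by
      rw [← ih w rfl]; congr 1; ext x; simp
    have h5 := gaussianReal_add_gaussianReal_of_indepFun h1 h4 h2
    rw [add_zero] at h5
    have h6 : v = w + NNReal.mk (a c ^ 2) (sq_nonneg _) * q := by
      rw [← NNReal.coe_inj, hv, Finset.sum_insert hc]
      simp only [hw, NNReal.coe_add, NNReal.coe_mul, NNReal.coe_mk]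
      ring
    rw [h6, ← h5]
    congr 1; ext x
    rw [Finset.sum_insert hc]; simp [add_comm]

theorem lintegral_linear_add_gaussian (q : ℝ≥0) (s : Finset C) (a : C → ℝ) (v : ℝ≥0)
    (hv : (v : ℝ) = (∑ c ∈ s, a c ^ 2) * q) {F : ℝ → ℝ≥0∞} (hF : Measurable F) :
    ∫⁻ x, ∫⁻ z, F (z + ∑ c ∈ s, a c * x c) ∂gaussianReal 0 1
        ∂(Measure.pi fun _ : C => gaussianReal 0 q)
      = ∫⁻ y, F y ∂gaussianReal 0 (1 + v) := by
  have h1 : gaussianReal 0 (1 + v) = (gaussianReal 0 v) ∗ (gaussianReal 0 1) := by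
    rw [gaussianReal_conv_gaussianReal, add_zero, add_comm]
  rw [h1, Measure.lintegral_conv hF, ← map_sum_mul_pi_gaussianReal q s a v hv,
    lintegral_map (Measurable.lintegral_prod_right'
      (f := fun p : ℝ × ℝ => F (p.1 + p.2)) (by fun_prop)) (by fun_prop)]
  simp_rw [add_comm]

/-- The sums over `s` and `t` use disjoint coordinates and are therefore independent, so
`lintegral_exp_sub_sq_gaussianReal` applies conditionally on everything but the second sum. -/
theorem lintegral_exp_competitor (q : ℝ≥0) {s t : Finset C} (hst : Disjoint s t) (a b : C → ℝ)
    (τ : ℝ≥0) (hτ : τ ≠ 0) (hb : (τ : ℝ) = (∑ c ∈ t, b c ^ 2) * q) :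
    ∫⁻ x, ∫⁻ z, ENNReal.ofReal (Real.exp (((z + ∑ c ∈ s, a c * x c) ^ 2 / (1 + τ)
        - (z + ∑ c ∈ s, a c * x c - ∑ c ∈ t, b c * x c) ^ 2) / 2)) ∂gaussianReal 0 1
        ∂(Measure.pi fun _ : C => gaussianReal 0 q)
      = ENNReal.ofReal (√(1 + τ))⁻¹ := by
  classical
  set γ := Measure.pi fun _ : C => gaussianReal 0 q
  let A : (C → ℝ) → ℝ := fun x => ∑ c ∈ s, a c * x c
  let V : (C → ℝ) → ℝ := fun x => ∑ c ∈ t, b c * x c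
  have hA : Measurable A := by fun_prop
  have hV : Measurable V := by fun_prop
  have hind : IndepFun A V γ := by
    have h1 := (iIndepFun_coord (C := C) q).indepFun_finset s t hst fun c => measurable_pi_apply c
    have h2 := h1.comp (φ := fun y => ∑ c : s, a c * y c) (ψ := fun y => ∑ c : t, b c * y c)
      (by fun_prop) (by fun_prop)
    convert h2 using 1
    · ext x; simp only [A, Function.comp]; rw [← Finset.sum_coe_sort]
    · ext x; simp only [V, Function.comp]; rw [← Finset.sum_coe_sort]
  have hlaw : γ.map V = gaussianReal 0 τ := map_sum_mul_pi_gaussianReal q t b τ hb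
  have hjoint := hind.map_prod_eq_prod_map_map hA.aemeasurable hV.aemeasurable
  let G : ℝ × ℝ → ℝ≥0∞ := fun p => ∫⁻ z, ENNReal.ofReal (Real.exp (((z + p.1) ^ 2 / (1 + τ)
        - (z + p.1 - p.2) ^ 2) / 2)) ∂gaussianReal 0 1
  have hG : Measurable G := Measurable.lintegral_prod_right'
      (f := fun p : (ℝ × ℝ) × ℝ => ENNReal.ofReal (Real.exp (((p.2 + p.1.1) ^ 2 / (1 + τ)
        - (p.2 + p.1.1 - p.1.2) ^ 2) / 2))) (by fun_prop)
  have hAP : IsProbabilityMeasure (γ.map A) := Measure.isProbabilityMeasure_map hA.aemeasurable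
  calc _ = ∫⁻ x, G (A x, V x) ∂γ := rfl
    _ = ∫⁻ p, G p ∂((γ.map A).prod (γ.map V)) := by
        rw [← hjoint, lintegral_map hG (by fun_prop)]
    _ = ∫⁻ α, ∫⁻ β, G (α, β) ∂gaussianReal 0 τ ∂(γ.map A) := by
        rw [lintegral_prod _ hG.aemeasurable, hlaw]
    _ = ∫⁻ α, ENNReal.ofReal (√(1 + τ))⁻¹ ∂(γ.map A) := by
        refine lintegral_congr fun α => ?_
        simp only [G]
        -- Integrating over the competing sum before the noise leaves a constant integrand.
        rw [lintegral_lintegral_swap (by fun_prop)]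
        simp_rw [lintegral_exp_sub_sq_gaussianReal hτ]
        simp
    _ = _ := by simp

end LinearCombinations

/-! ### Exponential bounds for the error events over a block. -/

section Tails

variable {C : Type*} [Fintype C] {ℓ : ℕ}

/-- The law of `ℓ` independent Gaussian columns of variance `q`, one entry for each codeword. -/
noncomputable def codebookLaw (C : Type*) [Fintype C] (q : ℝ≥0) (ℓ : ℕ) :
    Measure (Fin ℓ → C → ℝ) :=
  Measure.pi fun _ => Measure.pi fun _ => gaussianReal 0 q

instance (q : ℝ≥0) : IsProbabilityMeasure (codebookLaw C q ℓ) := by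
  unfold codebookLaw; infer_instance

/-- The law of `ℓ` independent standard Gaussians. -/
noncomputable def blockNoise (ℓ : ℕ) : Measure (Fin ℓ → ℝ) := Measure.pi fun _ => gaussianReal 0 1

instance : IsProbabilityMeasure (blockNoise ℓ) := by unfold blockNoise; infer_instance

theorem codebookLaw_power_le (c : C) {q : ℝ≥0} (hq : q ≠ 0) {P : ℝ} (hP : (q : ℝ) < P) :
    codebookLaw C q ℓ {X | ℓ * P < ∑ k, X k c ^ 2} ≤ ENNReal.ofReal (chernoffBase (P / q)) ^ ℓ := by
  have hq0 : (0 : ℝ) < q := by positivity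
  have ha : 1 < P / q := by rwa [one_lt_div hq0]
  have ha0 : 0 < P / q := by linarith
  have h1 := pi_sum_nonneg_le (ι := Fin ℓ) (Measure.pi fun _ : C => gaussianReal 0 q)
    (f := fun x => (1 - (P / q)⁻¹) / 2 * (x c ^ 2 / q - P / q)) (by fun_prop)
  rw [(measurePreserving_eval (fun _ : C => gaussianReal 0 q) c).lintegral_comp
      (f := fun x => ENNReal.ofReal (Real.exp ((1 - (P / q)⁻¹) / 2 * (x ^ 2 / q - P / q))))
      (by fun_prop), lintegral_exp_sq_gaussianReal hq ha0, Fintype.card_fin] at h1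
  refine le_trans (measure_mono fun X hX => ?_) h1
  simp only [Set.mem_ofPred_eq] at hX ⊢
  rw [← Finset.mul_sum, Finset.sum_sub_distrib, ← Finset.sum_div, Finset.sum_const,
    Finset.card_univ, Fintype.card_fin, nsmul_eq_mul, ← mul_div_assoc, ← sub_div]
  have h2 := inv_lt_one_of_one_lt₀ ha
  have h3 : 0 ≤ 1 - (P / q)⁻¹ := by linarith
  have h4 : 0 ≤ ∑ k, X k c ^ 2 - ℓ * P := by linarith
  positivity

theorem blockNoise_upper_tail_le (q : ℝ≥0) {ε : ℝ} (hε : 0 < ε) :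
    ((codebookLaw C q ℓ).prod (blockNoise ℓ)) {p | ℓ * (1 + ε) < ∑ k, p.2 k ^ 2}
      ≤ ENNReal.ofReal (chernoffBase (1 + ε)) ^ ℓ := by
  have h1 := pi_prod_pi_sum_nonneg_le (ι := Fin ℓ) (Measure.pi fun _ : C => gaussianReal 0 q)
    (gaussianReal 0 1)
    (f := fun _ z => (1 - (1 + ε)⁻¹) / 2 * (z ^ 2 / (1 : ℝ≥0) - (1 + ε))) (by fun_prop)
  simp_rw [lintegral_exp_sq_gaussianReal one_ne_zero (show 0 < 1 + ε by linarith)] at h1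
  rw [lintegral_const, measure_univ, mul_one, Fintype.card_fin] at h1
  refine le_trans (measure_mono fun p hp => ?_) h1
  simp only [Set.mem_ofPred_eq, NNReal.coe_one, div_one] at hp ⊢
  rw [← Finset.mul_sum, Finset.sum_sub_distrib, Finset.sum_const,
    Finset.card_univ, Fintype.card_fin, nsmul_eq_mul]
  have h2 := inv_lt_one_of_one_lt₀ (show 1 < 1 + ε by linarith)
  exact mul_nonneg (by linarith) (by linarith)

theorem linear_lower_tail_le (q : ℝ≥0) (s : Finset C) (a : C → ℝ) {v : ℝ}
    (hv : v = (∑ c ∈ s, a c ^ 2) * q) {ε : ℝ} (hε : 0 < ε) (hε1 : ε < 1) :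
    ((codebookLaw C q ℓ).prod (blockNoise ℓ))
        {p | ∑ k, (p.2 k + ∑ c ∈ s, a c * p.1 k c) ^ 2 < ℓ * ((1 + v) * (1 - ε))}
      ≤ ENNReal.ofReal (chernoffBase (1 - ε)) ^ ℓ := by
  have hv0 : 0 ≤ v := by rw [hv]; positivity
  lift v to ℝ≥0 using hv0
  have h1 := pi_prod_pi_sum_nonneg_le (ι := Fin ℓ) (Measure.pi fun _ : C => gaussianReal 0 q)
    (gaussianReal 0 1)
    (f := fun x z => (1 - (1 - ε)⁻¹) / 2 *
      ((z + ∑ c ∈ s, a c * x c) ^ 2 / (1 + v : ℝ≥0) - (1 - ε))) (by fun_prop)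
  rw [lintegral_linear_add_gaussian q s a v hv
    (F := fun y => ENNReal.ofReal (Real.exp ((1 - (1 - ε)⁻¹) / 2 *
      (y ^ 2 / (1 + v : ℝ≥0) - (1 - ε))))) (by fun_prop),
    lintegral_exp_sq_gaussianReal (by positivity) (by linarith), Fintype.card_fin] at h1
  refine le_trans (measure_mono fun p hp => ?_) h1
  simp only [Set.mem_ofPred_eq, NNReal.coe_add, NNReal.coe_one] at hp ⊢
  rw [← Finset.mul_sum, Finset.sum_sub_distrib, ← Finset.sum_div, Finset.sum_const,
    Finset.card_univ, Fintype.card_fin, nsmul_eq_mul]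
  have h2 := one_lt_inv_iff₀.2 ⟨show 0 < 1 - ε by linarith, by linarith⟩
  refine mul_nonneg_of_nonpos_of_nonpos (by linarith) ?_
  rw [sub_nonpos, div_le_iff₀ (by positivity)]
  linarith

theorem competitor_le {q : ℝ≥0} {s t : Finset C} (hst : Disjoint s t) (a b : C → ℝ)
    {τ : ℝ} (hτ : 0 < τ) (hb : τ = (∑ c ∈ t, b c ^ 2) * q) (ε : ℝ) :
    ((codebookLaw C q ℓ).prod (blockNoise ℓ))
        {p | ℓ * ((1 + τ) * (1 - ε)) ≤ ∑ k, (p.2 k + ∑ c ∈ s, a c * p.1 k c) ^ 2 ∧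
          ∑ k, (p.2 k + ∑ c ∈ s, a c * p.1 k c - ∑ c ∈ t, b c * p.1 k c) ^ 2 ≤ ℓ * (1 + ε)}
      ≤ ENNReal.ofReal (Real.exp ε * (√(1 + τ))⁻¹) ^ ℓ := by
  lift τ to ℝ≥0 using hτ.le
  have hτ0 : τ ≠ 0 := by rintro rfl; simp at hτ
  -- On the event, `∑ (Y² / (1 + τ) - (Y - V)²) / 2` is at least `ℓ((1 - ε) - (1 + ε)) / 2 = -ℓ ε`.
  -- The summand `ε` compensates for this and causes the factor `exp ε`.
  have h1 := pi_prod_pi_sum_nonneg_le (ι := Fin ℓ) (Measure.pi fun _ : C => gaussianReal 0 q)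
    (gaussianReal 0 1)
    (f := fun x z => ε + ((z + ∑ c ∈ s, a c * x c) ^ 2 / (1 + τ)
        - (z + ∑ c ∈ s, a c * x c - ∑ c ∈ t, b c * x c) ^ 2) / 2) (by fun_prop)
  simp_rw [Real.exp_add, ENNReal.ofReal_mul (Real.exp_pos ε).le] at h1
  have h3 : ∀ x : C → ℝ, ∫⁻ z, ENNReal.ofReal (Real.exp ε) *
      ENNReal.ofReal (Real.exp (((z + ∑ c ∈ s, a c * x c) ^ 2 / (1 + τ)
        - (z + ∑ c ∈ s, a c * x c - ∑ c ∈ t, b c * x c) ^ 2) / 2)) ∂gaussianReal 0 1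
      = ENNReal.ofReal (Real.exp ε) *
      ∫⁻ z, ENNReal.ofReal (Real.exp (((z + ∑ c ∈ s, a c * x c) ^ 2 / (1 + τ)
        - (z + ∑ c ∈ s, a c * x c - ∑ c ∈ t, b c * x c) ^ 2) / 2)) ∂gaussianReal 0 1 :=
    fun x => lintegral_const_mul _ (by fun_prop)
  simp_rw [h3] at h1
  rw [lintegral_const_mul _ (Measurable.lintegral_prod_right'
      (f := fun p : (C → ℝ) × ℝ => ENNReal.ofReal (Real.exp
        (((p.2 + ∑ c ∈ s, a c * p.1 c) ^ 2 / (1 + τ)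
        - (p.2 + ∑ c ∈ s, a c * p.1 c - ∑ c ∈ t, b c * p.1 c) ^ 2) / 2))) (by fun_prop)),
    lintegral_exp_competitor q hst a b τ hτ0 hb, Fintype.card_fin,
    ← ENNReal.ofReal_mul (Real.exp_pos ε).le] at h1
  refine le_trans (measure_mono fun p hp => ?_) h1
  simp only [Set.mem_ofPred_eq] at hp ⊢
  obtain ⟨hp1, hp2⟩ := hp
  rw [Finset.sum_add_distrib, ← Finset.sum_div, Finset.sum_sub_distrib, ← Finset.sum_div,
    Finset.sum_const, Finset.card_univ, Fintype.card_fin, nsmul_eq_mul]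
  have h2 : ℓ * (1 - ε) ≤ (∑ k, (p.2 k + ∑ c ∈ s, a c * p.1 k c) ^ 2) / (1 + τ) := by
    rw [le_div_iff₀ (by positivity)]; linarith
  linarith

end Tails

/-! ### Joint decoding with random codebooks. -/

section RandomCoding

variable {ι : Type*} {V : ι → Type*} {ℓ : ℕ}

/-- The embedding of the users in the set of codewords given by a choice of messages. -/
def choice (w : ∀ j, V j) : ι ↪ Σ j, V j :=
  ⟨fun j => ⟨j, w j⟩, fun _ _ h => congrArg Sigma.fst h⟩

theorem choice_apply (w : ∀ j, V j) (j : ι) : choice w j = ⟨j, w j⟩ := rfl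

variable [Fintype ι]

/-- The noiseless superposition of the codewords chosen by `w`, with gains `g`. -/
noncomputable def signal (g : ι → ℝ) (X : Fin ℓ → (Σ j, V j) → ℝ) (w : ∀ j, V j) (k : Fin ℓ) : ℝ :=
  ∑ j, g j * X k ⟨j, w j⟩

/-- The received block `y` is within distance `√(ℓ (1 + ε))` of the signal of `w`. -/
def Compat (ε : ℝ) (g : ι → ℝ) (X : Fin ℓ → (Σ j, V j) → ℝ) (y : Fin ℓ → ℝ) (w : ∀ j, V j) : Prop :=
  ∑ k, (y k - signal g X w k) ^ 2 ≤ ℓ * (1 + ε)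

/-- Among the candidates in `A`, the set `D` contains `w` and nothing else. -/
def DecodesTo {W : Type*} (D : W → Prop) (A : Set W) (w : W) : Prop :=
  D w ∧ ∀ w' ∈ A, D w' → w' = w

/-- The observation enters only through the set of accepted tuples, a point of a finite space, where
every set is measurable. -/
theorem measurableSet_decodesTo {W α : Type*} [Finite W] [MeasurableSpace α] {D : α → W → Prop}
    (hD : Measurable D) (A : Set W) (w : W) : MeasurableSet {x | DecodesTo (D x) A w} :=
  hD (Set.toFinite {s : W → Prop | DecodesTo s A w}).measurableSet


theorem measurable_compat {α : Type*} [MeasurableSpace α] (ε : ℝ) (g : ι → ℝ)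
    {X : α → Fin ℓ → (Σ j, V j) → ℝ} (hX : Measurable X) {y : α → Fin ℓ → ℝ} (hy : Measurable y) :
    Measurable fun p => Compat ε g (X p) (y p) := by
  refine measurable_pi_iff.2 fun w => measurableSet_setOfPred.1 ?_
  simp only [Compat, signal]
  refine measurableSet_le ?_ measurable_const
  have h1 : ∀ k c, Measurable fun p => X p k c := fun k c => by fun_prop
  fun_prop

open Classical in
/-- The users whose messages differ. -/
noncomputable def diffSet (w w' : ∀ j, V j) : Finset ι := Finset.univ.filter fun j => w j ≠ w' j

/-- The bound for the error probability of joint decoding with random codebooks of block length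
`ℓ`, where `N S` bounds the number of competitors that differ in `S`. -/
noncomputable def errorBound (ε P : ℝ) (q : ℝ≥0) (g : ι → ℝ) (N : Finset ι → ℕ) (ℓ : ℕ) : ℝ≥0∞ :=
  Fintype.card ι * ENNReal.ofReal (chernoffBase (P / q)) ^ ℓ
    + (ENNReal.ofReal (chernoffBase (1 + ε)) ^ ℓ
    + ∑ S : Finset ι with S.Nonempty, (ENNReal.ofReal (chernoffBase (1 - ε)) ^ ℓ
        + N S * ENNReal.ofReal (Real.exp ε * (√(1 + (∑ j ∈ S, g j ^ 2) * q))⁻¹) ^ ℓ))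

/-- Codewords common to both tuples cancel; what remains is indexed by the users whose messages
differ. -/
theorem sub_signal_eq (g : ι → ℝ) (X : Fin ℓ → (Σ j, V j) → ℝ) (w w' : ∀ j, V j) (z : ℝ)
    (k : Fin ℓ) :
    signal g X w k + z - signal g X w' k
      = z + ∑ c ∈ (diffSet w w').map (choice w), g c.1 * X k c
        - ∑ c ∈ (diffSet w w').map (choice w'), g c.1 * X k c := by
  have h1 : ∑ j, (g j * X k ⟨j, w j⟩ - g j * X k ⟨j, w' j⟩)
      = ∑ j ∈ diffSet w w', (g j * X k ⟨j, w j⟩ - g j * X k ⟨j, w' j⟩) := by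
    refine (Finset.sum_subset (Finset.subset_univ _) fun j _ hj => ?_).symm
    have : w j = w' j := by simpa [diffSet] using hj
    rw [this, sub_self]
  rw [Finset.sum_sub_distrib, Finset.sum_sub_distrib] at h1
  simp only [signal, Finset.sum_map, choice_apply]
  linarith

variable [∀ j, Fintype (V j)]

open Classical in
theorem decoding_error_le {g : ι → ℝ} (hg : ∀ j, g j ≠ 0) (A : Set (∀ j, V j)) (w : ∀ j, V j)
    (N : Finset ι → ℕ)
    (hN : ∀ S : Finset ι, S.Nonempty →
      (Finset.univ.filter fun w' => w' ∈ A ∧ diffSet w w' = S).card ≤ N S)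
    {ε : ℝ} (hε : 0 < ε) (hε1 : ε < 1) {q : ℝ≥0} (hq : q ≠ 0) :
    ((codebookLaw (Σ j, V j) q ℓ).prod (blockNoise ℓ))
        {p | ¬ DecodesTo (Compat ε g p.1 fun k => signal g p.1 w k + p.2 k) A w}
      ≤ ENNReal.ofReal (chernoffBase (1 + ε)) ^ ℓ
        + ∑ S : Finset ι with S.Nonempty, (ENNReal.ofReal (chernoffBase (1 - ε)) ^ ℓ
          + N S * ENNReal.ofReal (Real.exp ε * (√(1 + (∑ j ∈ S, g j ^ 2) * q))⁻¹) ^ ℓ) := by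
  set μ := (codebookLaw (Σ j, V j) q ℓ).prod (blockNoise ℓ)
  let τ : Finset ι → ℝ := fun S => (∑ j ∈ S, g j ^ 2) * q
  have hsum : ∀ (S : Finset ι) (w : ∀ j, V j), τ S = (∑ c ∈ S.map (choice w), g c.1 ^ 2) * q :=
    fun S w => by simp only [τ, Finset.sum_map, choice_apply]
  let E₀ : Set ((Fin ℓ → (Σ j, V j) → ℝ) × (Fin ℓ → ℝ)) := {p | ℓ * (1 + ε) < ∑ k, p.2 k ^ 2}
  -- This event involves only the true codewords in `S`, so it is paid for once per `S` and not once
  -- per competitor; its exponent need not beat the number of competitors.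
  let E₁ : Finset ι → Set ((Fin ℓ → (Σ j, V j) → ℝ) × (Fin ℓ → ℝ)) := fun S =>
    {p | ∑ k, (p.2 k + ∑ c ∈ S.map (choice w), g c.1 * p.1 k c) ^ 2 < ℓ * ((1 + τ S) * (1 - ε))}
  let E₂ : Finset ι → (∀ j, V j) → Set ((Fin ℓ → (Σ j, V j) → ℝ) × (Fin ℓ → ℝ)) := fun S w' =>
    {p | ℓ * ((1 + τ S) * (1 - ε)) ≤ ∑ k, (p.2 k + ∑ c ∈ S.map (choice w), g c.1 * p.1 k c) ^ 2 ∧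
      ∑ k, (p.2 k + ∑ c ∈ S.map (choice w), g c.1 * p.1 k c
        - ∑ c ∈ S.map (choice w'), g c.1 * p.1 k c) ^ 2 ≤ ℓ * (1 + ε)}
  let comp : Finset ι → Finset (∀ j, V j) := fun S =>
    Finset.univ.filter fun w' => w' ∈ A ∧ diffSet w w' = S
  have hsub : {p : (Fin ℓ → (Σ j, V j) → ℝ) × (Fin ℓ → ℝ) |
      ¬ DecodesTo (Compat ε g p.1 fun k => signal g p.1 w k + p.2 k) A w}
      ⊆ E₀ ∪ ⋃ S ∈ Finset.univ.filter Finset.Nonempty, (E₁ S ∪ ⋃ w' ∈ comp S, E₂ S w') := by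
    intro p hp
    by_contra hcon
    simp only [Set.mem_union, Set.mem_iUnion, not_or, not_exists] at hcon
    obtain ⟨h0, h1⟩ := hcon
    refine hp ⟨?_, fun w' hw' hc => ?_⟩
    · simpa [Compat, E₀] using h0
    · by_contra hne
      have hS : (diffSet w w').Nonempty := by
        obtain ⟨j, hj⟩ := Function.ne_iff.1 hne
        exact ⟨j, by simpa [diffSet] using fun h => hj h.symm⟩
      obtain ⟨h2, h3⟩ := h1 _ (by simpa using hS)
      refine h3 w' (by simp [comp, hw']) ⟨not_lt.1 h2, ?_⟩
      simpa only [Compat, sub_signal_eq] using hc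
  have h0 : μ E₀ ≤ ENNReal.ofReal (chernoffBase (1 + ε)) ^ ℓ := blockNoise_upper_tail_le q hε
  have h1 : ∀ S, μ (E₁ S) ≤ ENNReal.ofReal (chernoffBase (1 - ε)) ^ ℓ := fun S =>
    linear_lower_tail_le q _ _ (hsum S w) hε hε1
  have h2 : ∀ S : Finset ι, S.Nonempty → ∀ w' ∈ comp S, μ (E₂ S w')
      ≤ ENNReal.ofReal (Real.exp ε * (√(1 + τ S))⁻¹) ^ ℓ := fun S hS w' hw' => by
    -- Nonzero gains make the difference signal nondegenerate.
    have hτ : 0 < τ S := mul_pos (Finset.sum_pos (fun j _ => by have := hg j; positivity) hS)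
      (by positivity)
    have hdisj : Disjoint (S.map (choice w)) (S.map (choice w')) := by
      rw [Finset.disjoint_left]
      intro c hc hc'
      obtain ⟨j, hj, rfl⟩ := Finset.mem_map.1 hc
      obtain ⟨i, hi, hij⟩ := Finset.mem_map.1 hc'
      have h1 : i = j := congrArg Sigma.fst hij
      subst h1
      have h2 : w' i = w i := eq_of_heq (Sigma.mk.inj hij).2
      rw [← (Finset.mem_filter.1 hw').2.2] at hi
      exact (Finset.mem_filter.1 hi).2 h2.symm
    exact competitor_le hdisj (fun c => g c.1) (fun c => g c.1) hτ (hsum S w') ε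
  refine (measure_mono hsub).trans ((measure_union_le _ _).trans (add_le_add h0
    ((measure_biUnion_finset_le _ _).trans (Finset.sum_le_sum fun S hS => ?_))))
  have hSne : S.Nonempty := (Finset.mem_filter.1 hS).2
  refine (measure_union_le _ _).trans (add_le_add (h1 S) ?_)
  refine (measure_biUnion_finset_le _ _).trans
    ((Finset.sum_le_card_nsmul _ _ _ (h2 S hSne)).trans ?_)
  rw [nsmul_eq_mul]
  exact mul_le_mul_left (Nat.cast_le.2 (hN S hSne)) _

/-- Some realization is no worse than the average. Summing over `θ` and `r` before choosing it
yields a single codebook for all receivers. -/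
theorem exists_sum_measure_section_le {α β Θ R : Type*} [MeasurableSpace α] [MeasurableSpace β]
    [Fintype Θ] [Fintype R] (μ : Measure α) (ν : Measure β) [IsProbabilityMeasure μ]
    [IsProbabilityMeasure ν] {bad : Θ → R → Set (α × β)} (hbadm : ∀ θ r, MeasurableSet (bad θ r))
    (b : R → ℝ≥0∞) (hbad : ∀ θ r, (μ.prod ν) (bad θ r) ≤ b r) :
    ∃ X, ∑ θ, ∑ r, ν (Prod.mk X ⁻¹' bad θ r) ≤ Fintype.card Θ * ∑ r, b r := by
  have hm : ∀ θ r, Measurable fun X => ν (Prod.mk X ⁻¹' bad θ r) := fun θ r =>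
    measurable_measure_prodMk_left (hbadm θ r)
  obtain ⟨X, hX⟩ := exists_le_lintegral (μ := μ)
    (f := fun X => ∑ θ, ∑ r, ν (Prod.mk X ⁻¹' bad θ r))
    (Finset.measurable_sum _ fun θ _ => Finset.measurable_sum _ fun r _ => hm θ r).aemeasurable
  refine ⟨X, hX.trans ?_⟩
  rw [lintegral_finsetSum _ fun θ _ => Finset.measurable_sum _ fun r _ => hm θ r]
  have h1 : ∀ θ : Θ, ∫⁻ X, ∑ r, ν (Prod.mk X ⁻¹' bad θ r) ∂μ ≤ ∑ r, b r := fun θ => by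
    rw [lintegral_finsetSum _ fun r _ => hm θ r]
    exact Finset.sum_le_sum fun r _ => (Measure.prod_apply (hbadm θ r)).symm.trans_le (hbad θ r)
  refine (Finset.sum_le_card_nsmul _ _ _ fun θ _ => h1 θ).trans_eq ?_
  rw [nsmul_eq_mul, Finset.card_univ]

open Classical in
/-- Random coding for joint decoding: there are codebooks of bounded power and decoders, the same
for all receivers `r` and messages `w θ`, whose total error probability is at most its average
over random codebooks. -/
theorem exists_codebook {R Θ : Type*} [Fintype R] [Fintype Θ] {g : R → ι → ℝ}
    (hg : ∀ r j, g r j ≠ 0) (A : R → (∀ j, V j) → Set (∀ j, V j)) (N : R → Finset ι → ℕ)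
    (hN : ∀ r w, ∀ S : Finset ι, S.Nonempty →
      (Finset.univ.filter fun w' => w' ∈ A r w ∧ diffSet w w' = S).card ≤ N r S)
    (w : Θ → ∀ j, V j) {ε P : ℝ} (hε : 0 < ε) (hε1 : ε < 1) {q : ℝ≥0} (hq : q ≠ 0)
    (hqP : (q : ℝ) < P) (ℓ : ℕ) :
    ∃ (x : (j : ι) → V j → Fin ℓ → ℝ) (D : R → (Fin ℓ → ℝ) → (∀ j, V j) → Prop),
      (∀ j v, ∑ k, x j v k ^ 2 ≤ ℓ * P) ∧ (∀ r, Measurable (D r)) ∧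
      ∑ θ, ∑ r, blockNoise ℓ {ζ | ¬ DecodesTo
        (D r fun k => ∑ j, g r j * x j (w θ j) k + ζ k) (A r (w θ)) (w θ)}
      ≤ Fintype.card Θ * ∑ r, errorBound ε P q (g r) (N r) ℓ := by
  -- Excess power of a transmitted codeword counts as an error, so that such codewords may be erased
  -- afterwards.
  let bad : Θ → R → Set ((Fin ℓ → (Σ j, V j) → ℝ) × (Fin ℓ → ℝ)) := fun θ r =>
    (⋃ j, {X | ℓ * P < ∑ k, X k ⟨j, w θ j⟩ ^ 2}) ×ˢ Set.univ ∪
    {p | ¬ DecodesTo (Compat ε (g r) p.1 fun k => signal (g r) p.1 (w θ) k + p.2 k)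
      (A r (w θ)) (w θ)}
  have hbadm : ∀ θ r, MeasurableSet (bad θ r) := fun θ r => by
    refine MeasurableSet.union (MeasurableSet.prod (MeasurableSet.iUnion fun j =>
      measurableSet_lt measurable_const (by fun_prop)) MeasurableSet.univ) ?_
    refine (measurableSet_decodesTo (measurable_compat ε (g r) measurable_fst ?_) _ _).compl
    unfold signal
    fun_prop
  have hbad : ∀ θ r, ((codebookLaw (Σ j, V j) q ℓ).prod (blockNoise ℓ)) (bad θ r)
      ≤ errorBound ε P q (g r) (N r) ℓ := fun θ r => by
    unfold errorBound
    refine (measure_union_le _ _).trans (add_le_add ?_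
      (decoding_error_le (hg r) _ _ _ (hN r (w θ)) hε hε1 hq))
    rw [Measure.prod_prod, measure_univ, mul_one]
    have h1 : ∀ j, codebookLaw (Σ j, V j) q ℓ {X | ℓ * P < ∑ k, X k ⟨j, w θ j⟩ ^ 2}
        ≤ ENNReal.ofReal (chernoffBase (P / q)) ^ ℓ := fun j => codebookLaw_power_le _ hq hqP
    refine (measure_iUnion_fintype_le _ _).trans
      ((Finset.sum_le_card_nsmul _ _ _ fun j _ => h1 j).trans_eq ?_)
    rw [nsmul_eq_mul, Finset.card_univ]
  obtain ⟨X, hX⟩ := exists_sum_measure_section_le _ _ hbadm _ hbad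
  -- Codewords violating the power constraint are sent as zero, while the decoder still compares
  -- with `X`. Outside `bad` the transmitted codewords are unchanged.
  refine ⟨fun j v k => if ∑ k, X k ⟨j, v⟩ ^ 2 ≤ ℓ * P then X k ⟨j, v⟩ else 0,
    fun r y => Compat ε (g r) X y, fun j v => ?_,
    fun r => measurable_compat ε (g r) measurable_const measurable_id, le_trans ?_ hX⟩
  · dsimp only
    split_ifs with h
    · exact h
    · have : 0 ≤ P := q.2.trans hqP.le
      simpa using by positivity
  · refine Finset.sum_le_sum fun θ _ => Finset.sum_le_sum fun r _ => measure_mono fun ζ hζ => ?_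
    by_contra hcon
    simp only [bad, Set.mem_preimage, Set.mem_union, Set.mem_prod, Set.mem_iUnion, Set.mem_univ,
      and_true, Set.mem_ofPred_eq, not_or, not_exists, not_lt, not_not] at hcon
    refine hζ ?_
    convert hcon.2 using 4 with k
    simp only [signal]
    refine Finset.sum_congr rfl fun j _ => ?_
    rw [if_pos (hcon.1 j)]

end RandomCoding

/-! ### Received signals and the block structure of a scheme. -/

section Received

variable {M : Pair → ℕ} {n : ℕ} (h : Fin 3 → ℝ) (c : Code M n) (m : Msgs M) (z : Noise n)

theorem received_fst (t : ℕ) (ht : t ≤ n) (i : Fin t) :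
    (received h c m z t ht).1 i
      = ∑ j, h j * userInput h c m z j (i.castLE ht) + z.1 (i.castLE ht) := by
  induction t with
  | zero => exact i.elim0
  | succ t ih =>
    refine Fin.lastCases ?_ (fun i => ?_) i
    · simp only [received, Fin.snoc_last]
      rfl
    · simp only [received, Fin.snoc_castSucc]
      exact ih _ i

theorem received_snd (t : ℕ) (ht : t ≤ n) (j : Fin 3) (i : Fin t) :
    (received h c m z t ht).2 j i
      = h j * relayInput h c m z (i.castLE ht) + z.2 j (i.castLE ht) := by
  induction t with
  | zero => exact i.elim0
  | succ t ih =>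
    refine Fin.lastCases ?_ (fun i => ?_) i
    · simp only [received, Fin.snoc_last]
      rfl
    · simp only [received, Fin.snoc_castSucc]
      exact ih _ i

theorem received_fst_castLE (t : ℕ) (ht : t ≤ n) (i : Fin t) :
    (received h c m z t ht).1 i = (received h c m z n le_rfl).1 (i.castLE ht) := by
  rw [received_fst, received_fst]
  rfl

end Received

section Blocks

theorem mul_add_div_block {ℓ b : ℕ} (k : Fin ℓ) : (b * ℓ + k) / ℓ = b := by
  have hℓ : 0 < ℓ := k.pos
  rw [mul_comm, Nat.mul_add_div hℓ, Nat.div_eq_of_lt k.2, add_zero]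

theorem mul_add_mod_block {ℓ b : ℕ} (k : Fin ℓ) : (b * ℓ + k) % ℓ = k := by
  rw [mul_comm, Nat.mul_add_mod, Nat.mod_eq_of_lt k.2]

theorem sum_range_blocks_le {F : ℕ → ℝ≥0∞} {ℓ D : ℕ} {U : ℝ≥0∞}
    (hF : ∀ b, ∑ k : Fin ℓ, F (b * ℓ + k) ≤ U) (hz : ∀ i, D * ℓ ≤ i → F i = 0) (n : ℕ) :
    ∑ i ∈ Finset.range n, F i ≤ D * U := by
  have h1 : ∀ b : ℕ, ∑ i ∈ Finset.range (b * ℓ), F i ≤ b * U := fun b => by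
    induction b with
    | zero => simp
    | succ b ih =>
      rw [Nat.succ_mul, Finset.sum_range_add, Nat.cast_succ, add_mul, one_mul]
      refine add_le_add ih ?_
      rw [← Fin.sum_univ_eq_sum_range (fun k => F (b * ℓ + k))]
      exact hF b
  refine le_trans ?_ (h1 D)
  -- The horizon `n` may lie on either side of `D * ℓ`, and beyond `D * ℓ` nothing is sent.
  have h2 : ∑ i ∈ Finset.range n, F i ≤ ∑ i ∈ Finset.range (max n (D * ℓ)), F i :=
    Finset.sum_le_sum_of_subset (Finset.range_mono (le_max_left _ _))
  refine h2.trans_eq (Finset.sum_subset (Finset.range_mono (le_max_right _ _)) ?_).symm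
  intro i _ hi
  exact hz i (by simpa using hi)

end Blocks

namespace CDFCode

variable {M : Pair → ℕ} {n : ℕ} (s : CDFCode M n) (h : Fin 3 → ℝ) (m : Msgs M) (z : Noise n)

/-- The submessages of block `b`. -/
def sub (b : Fin s.B) : Msgs s.K := fun p => s.split p (m p) b

/-- The noise at the relay in block `b`. -/
def relayNoise (b : Fin s.B) (k : Fin s.ℓ) : ℝ := z.1 ⟨b * s.ℓ + k, s.index_lt b k⟩

theorem succ_index_lt (b : Fin s.B) (k : Fin s.ℓ) : (b + 1 : ℕ) * s.ℓ + k < n := by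
  have h1 : ((b : ℕ) + 1 + 1) * s.ℓ ≤ (s.B + 1) * s.ℓ := Nat.mul_le_mul_right _ (by omega)
  have h2 : ((b : ℕ) + 1 + 1) * s.ℓ = (b + 1) * s.ℓ + s.ℓ := Nat.succ_mul _ _
  have h3 := s.fits
  have h4 := k.2
  omega

/-- The noise at user `j` in the block after block `b`. -/
def userNoise (j : Fin 3) (b : Fin s.B) (k : Fin s.ℓ) : ℝ :=
  z.2 j ⟨(b + 1 : ℕ) * s.ℓ + k, s.succ_index_lt b k⟩

/-- What the relay receives in block `b`. -/
noncomputable def relayBlock (b : Fin s.B) (k : Fin s.ℓ) : ℝ :=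
  (received h s.toCode m z n le_rfl).1 ⟨b * s.ℓ + k, s.index_lt b k⟩

theorem userInput_of_div_eq (j : Fin 3) (i : Fin n) (b : Fin s.B) (k : Fin s.ℓ)
    (hb : (i : ℕ) / s.ℓ = b) (hk : (i : ℕ) % s.ℓ = k) :
    userInput h s.toCode m z j i = s.userBook j (sent (s.sub m b) j) k := by
  have h1 : (i : ℕ) / s.ℓ < s.B := hb ▸ b.2
  have h2 : (⟨(i : ℕ) / s.ℓ, h1⟩ : Fin s.B) = b := Fin.ext hb
  have h3 : (⟨(i : ℕ) % s.ℓ, Nat.mod_lt _ s.ℓ_pos⟩ : Fin s.ℓ) = k := Fin.ext hk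
  simp only [userInput, toCode, dif_pos h1, h2, h3]
  rfl

theorem userInput_of_le_div (j : Fin 3) (i : Fin n) (hb : s.B ≤ (i : ℕ) / s.ℓ) :
    userInput h s.toCode m z j i = 0 := by
  simp only [userInput, toCode, dif_neg hb.not_gt]

theorem relayInput_of_div_eq (i : Fin n) (b : Fin s.B) (k : Fin s.ℓ)
    (hb : (i : ℕ) / s.ℓ = b + 1) (hk : (i : ℕ) % s.ℓ = k) :
    relayInput h s.toCode m z i = s.relayBook (s.relayDec (s.relayBlock h m z b)) k := by
  have h1 : 1 ≤ (i : ℕ) / s.ℓ ∧ (i : ℕ) / s.ℓ ≤ s.B := by have := b.2; omega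
  have h3 : (⟨(i : ℕ) % s.ℓ, Nat.mod_lt _ s.ℓ_pos⟩ : Fin s.ℓ) = k := Fin.ext hk
  simp only [relayInput, toCode, dif_pos h1, h3]
  congr 2
  ext k'
  refine (received_fst_castLE h s.toCode m z _ _ _).trans ?_
  refine congrArg (received h s.toCode m z n le_rfl).1 (Fin.ext ?_)
  simp [hb]

theorem relayInput_of_not (i : Fin n) (hb : ¬ (1 ≤ (i : ℕ) / s.ℓ ∧ (i : ℕ) / s.ℓ ≤ s.B)) :
    relayInput h s.toCode m z i = 0 := by
  simp only [relayInput, toCode, dif_neg hb]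

theorem relayBlock_eq (b : Fin s.B) (k : Fin s.ℓ) :
    s.relayBlock h m z b k
      = ∑ j, h j * s.userBook j (sent (s.sub m b) j) k + s.relayNoise z b k := by
  rw [relayBlock, received_fst]
  simp_rw [s.userInput_of_div_eq h m z _ (Fin.castLE le_rfl ⟨b * s.ℓ + k, s.index_lt b k⟩) b k
    (mul_add_div_block k) (mul_add_mod_block k)]
  rfl

theorem received_user_block (j : Fin 3) (b : Fin s.B) (k : Fin s.ℓ) :
    (received h s.toCode m z n le_rfl).2 j ⟨(b + 1 : ℕ) * s.ℓ + k, s.succ_index_lt b k⟩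
      = h j * s.relayBook (s.relayDec (s.relayBlock h m z b)) k + s.userNoise z j b k := by
  rw [received_snd, s.relayInput_of_div_eq h m z
    (Fin.castLE le_rfl ⟨(b + 1 : ℕ) * s.ℓ + k, s.succ_index_lt b k⟩) b k
    (mul_add_div_block k) (mul_add_mod_block k)]
  rfl

end CDFCode

/-! ### The power constraint, from a deterministic bound on each codeword. -/

section Power

/-- Superadditivity of the lower integral, which requires no measurability of the channel inputs. -/
theorem sum_lintegral_le {α ι : Type*} [MeasurableSpace α] (μ : Measure α) (s : Finset ι)
    (f : ι → α → ℝ≥0∞) : ∑ i ∈ s, ∫⁻ x, f i x ∂μ ≤ ∫⁻ x, ∑ i ∈ s, f i x ∂μ := by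
  classical
  induction s using Finset.induction_on with
  | empty => simp
  | insert i s hi ih =>
    simp_rw [Finset.sum_insert hi]
    exact (add_le_add le_rfl ih).trans (le_lintegral_add _ _)

instance (n : ℕ) : IsProbabilityMeasure (noiseLaw n) := by unfold noiseLaw; infer_instance

theorem sum_expect_le {M : Pair → ℕ} {n : ℕ} {ι : Type*} [Fintype ι]
    (X : ι → Msgs M → Noise n → ℝ≥0∞) (c : ℝ≥0∞) (hX : ∀ m z, ∑ i, X i m z ≤ c) :
    ∑ i, expect (X i) ≤ c := by
  simp only [expect, div_eq_mul_inv]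
  rw [← Finset.sum_mul, ← div_eq_mul_inv, Finset.sum_comm]
  refine ENNReal.div_le_of_le_mul ?_
  refine (Finset.sum_le_card_nsmul _ _ c fun m _ => ?_).trans_eq ?_
  · refine (sum_lintegral_le _ _ _).trans ((lintegral_mono fun z => hX m z).trans_eq ?_)
    simp
  · rw [nsmul_eq_mul, Finset.card_univ, mul_comm]

namespace CDFCode

variable {M : Pair → ℕ} {n : ℕ} (s : CDFCode M n) (h : Fin 3 → ℝ)

theorem sum_le_of_blocks {P : ℝ} (x : Fin n → ℝ)
    (v : ℕ → Fin s.ℓ → ℝ) (hv : ∀ b, ∑ k, v b k ^ 2 ≤ s.ℓ * P)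
    (hx : ∀ i : Fin n, x i = v (i / s.ℓ) ⟨i % s.ℓ, Nat.mod_lt _ s.ℓ_pos⟩)
    (hz : ∀ b, s.B < b → v b = 0) :
    ∑ i, ENNReal.ofReal (x i ^ 2) ≤ n * ENNReal.ofReal P := by
  have h1 := sum_range_blocks_le (ℓ := s.ℓ) (D := s.B + 1) (U := s.ℓ * ENNReal.ofReal P)
    (F := fun i => ENNReal.ofReal (v (i / s.ℓ) ⟨i % s.ℓ, Nat.mod_lt _ s.ℓ_pos⟩ ^ 2))
    (fun b => ?_) (fun i hi => ?_) n
  · rw [← Fin.sum_univ_eq_sum_range] at h1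
    simp_rw [hx]
    refine h1.trans ?_
    rw [← mul_assoc]
    refine mul_le_mul_left ?_ _
    exact_mod_cast s.fits
  · simp only [mul_add_div_block, mul_add_mod_block]
    rw [← ENNReal.ofReal_sum_of_nonneg fun k _ => sq_nonneg _, ← ENNReal.ofReal_natCast,
      ← ENNReal.ofReal_mul (by positivity)]
    exact ENNReal.ofReal_le_ofReal (hv b)
  · have h2 : s.B < i / s.ℓ := (Nat.le_div_iff_mul_le s.ℓ_pos).2 hi
    simp [hz _ h2]

theorem powerConstraint {P : ℝ} (hP : 0 ≤ P)
    (hu : ∀ j v, ∑ k, s.userBook j v k ^ 2 ≤ s.ℓ * P)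
    (hr : ∀ w, ∑ k, s.relayBook w k ^ 2 ≤ s.ℓ * P) : PowerConstraint h P s.toCode := by
  have h0 : (0 : ℝ) ≤ s.ℓ * P := by positivity
  refine ⟨fun j => ENNReal.div_le_of_le_mul ?_, ENNReal.div_le_of_le_mul ?_⟩ <;>
  rw [mul_comm] <;>
  refine sum_expect_le _ _ fun m z => ?_
  · refine s.sum_le_of_blocks _
      (fun b => if hb : b < s.B then s.userBook j (sent (s.sub m ⟨b, hb⟩) j) else 0)
      (fun b => ?_) (fun i => ?_) (fun b hb => dif_neg hb.le.not_gt)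
    · split_ifs
      · exact hu _ _
      · simpa using h0
    · split_ifs with hb
      · exact s.userInput_of_div_eq h m z j i ⟨_, hb⟩ _ rfl rfl
      · exact s.userInput_of_le_div h m z j i (not_lt.1 hb)
  · refine s.sum_le_of_blocks _
      (fun b => if hb : 1 ≤ b ∧ b ≤ s.B then
        s.relayBook (s.relayDec (s.relayBlock h m z ⟨b - 1, by omega⟩)) else 0)
      (fun b => ?_) (fun i => ?_) (fun b hb => dif_neg (by omega))
    · split_ifs
      · exact hr _
      · simpa using h0
    · split_ifs with hb
      · exact s.relayInput_of_div_eq h m z i ⟨_, _⟩ _ (by simp only; omega) rfl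
      · exact s.relayInput_of_not h m z i hb

end CDFCode

end Power

/-! ### The noise in one block is again white. -/

section NoiseMarginals

theorem map_pi_gaussianReal_comp {n ℓ : ℕ} {e : Fin ℓ → Fin n} (he : Function.Injective e) :
    (Measure.pi fun _ : Fin n => gaussianReal 0 1).map (fun z k => z (e k)) = blockNoise ℓ := by
  have h1 := (iIndepFun_coord (C := Fin n) 1).precomp he
  rw [iIndepFun_iff_map_fun_eq_pi_map fun k => (measurable_pi_apply _).aemeasurable] at h1
  refine h1.trans ?_
  unfold blockNoise
  congr 1
  ext1 k
  exact (measurePreserving_eval (fun _ : Fin n => gaussianReal 0 1) (e k)).map_eq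

namespace CDFCode

variable {M : Pair → ℕ} {n : ℕ} (s : CDFCode M n)

theorem noiseLaw_relayNoise_le (b : Fin s.B) (E : Set (Fin s.ℓ → ℝ)) :
    noiseLaw n {z | s.relayNoise z b ∈ E} ≤ blockNoise s.ℓ E := by
  have he : Function.Injective fun k : Fin s.ℓ => (⟨b * s.ℓ + k, s.index_lt b k⟩ : Fin n) :=
    fun k k' hk => Fin.ext (by simpa using hk)
  have h1 : (noiseLaw n).map (fun z => s.relayNoise z b) = blockNoise s.ℓ := by
    rw [← map_pi_gaussianReal_comp he, ← (measurePreserving_fst (α := Fin n → ℝ)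
      (μ := Measure.pi fun _ => gaussianReal 0 1) (ν := Measure.pi fun _ : Fin 3 =>
        Measure.pi fun _ : Fin n => gaussianReal 0 1)).map_eq,
      Measure.map_map (by fun_prop) measurable_fst]
    rfl
  rw [← h1]
  refine Measure.le_map_apply (Measurable.aemeasurable ?_) E
  unfold relayNoise
  fun_prop

theorem noiseLaw_userNoise_le (j : Fin 3) (b : Fin s.B) (E : Set (Fin s.ℓ → ℝ)) :
    noiseLaw n {z | s.userNoise z j b ∈ E} ≤ blockNoise s.ℓ E := by
  have he : Function.Injective
      fun k : Fin s.ℓ => (⟨(b + 1 : ℕ) * s.ℓ + k, s.succ_index_lt b k⟩ : Fin n) :=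
    fun k k' hk => Fin.ext (by simpa using hk)
  have h2 := (measurePreserving_eval (fun _ : Fin 3 =>
    Measure.pi fun _ : Fin n => gaussianReal 0 1) j).comp (measurePreserving_snd (α := Fin n → ℝ)
      (μ := Measure.pi fun _ => gaussianReal 0 1) (ν := Measure.pi fun _ : Fin 3 =>
        Measure.pi fun _ : Fin n => gaussianReal 0 1))
  have h1 : (noiseLaw n).map (fun z => s.userNoise z j b) = blockNoise s.ℓ := by
    rw [← map_pi_gaussianReal_comp he, ← h2.map_eq, Measure.map_map (by fun_prop) h2.measurable]
    rfl
  rw [← h1]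
  refine Measure.le_map_apply (Measurable.aemeasurable ?_) E
  unfold userNoise
  fun_prop

end CDFCode

end NoiseMarginals

/-! ### Numbers of competing message tuples. -/

section Counting

open Classical in
theorem card_diffSet_eq_le {ι : Type*} [Fintype ι] {V : ι → Type*} [∀ j, Fintype (V j)]
    (w : ∀ j, V j) (A : Set (∀ j, V j)) (S : Finset ι) :
    (Finset.univ.filter fun w' => w' ∈ A ∧ diffSet w w' = S).card
      ≤ ∏ j ∈ S, Fintype.card (V j) := by
  have h1 : (Finset.univ.filter fun w' => w' ∈ A ∧ diffSet w w' = S)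
      ⊆ Fintype.piFinset fun j => if j ∈ S then Finset.univ else {w j} := by
    intro w' hw'
    have h2 := (Finset.mem_filter.1 hw').2.2
    refine Fintype.mem_piFinset.2 fun j => ?_
    split_ifs with hj
    · exact Finset.mem_univ _
    · rw [← h2] at hj
      simpa [diffSet, eq_comm] using hj
  refine (Finset.card_le_card h1).trans_eq ?_
  rw [Fintype.card_piFinset, ← Finset.prod_subset (Finset.subset_univ S)]
  · exact Finset.prod_congr rfl fun j hj => by rw [if_pos hj, Finset.card_univ]
  · intro j _ hj
    rw [if_neg hj, Finset.card_singleton]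

-- This is the gain from side information on the downlink: a user that knows its own messages faces
-- only tuples of the others. The relay is the sole transmitter there, hence the index type `Unit`.
open Classical in
theorem card_agree_le {ι : Type*} [Fintype ι] {V : ι → Type*} [∀ j, Fintype (V j)] (i : ι)
    (v : V i) (p : (Unit → ∀ j, V j) → Prop) (hp : ∀ w, p w → w () i = v) :
    (Finset.univ.filter p).card ≤ ∏ j ∈ Finset.univ.erase i, Fintype.card (V j) := by
  have h1 : (Finset.univ.filter p).card
      ≤ (Fintype.piFinset fun j => if h : j = i then ({h ▸ v} : Finset (V j)) else
        Finset.univ).card := by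
    refine Finset.card_le_card_of_injOn (fun w => w ()) (fun w hw => ?_) fun w _ w' _ hww' => ?_
    · have h2 := hp w (Finset.mem_filter.1 hw).2
      refine Finset.mem_coe.2 (Fintype.mem_piFinset.2 fun j => ?_)
      split_ifs with hj
      · subst hj
        simpa using h2
      · exact Finset.mem_univ _
    · exact funext fun _ => hww'
  refine h1.trans_eq ?_
  rw [Fintype.card_piFinset, ← Finset.mul_prod_erase _ _ (Finset.mem_univ i), dif_pos rfl,
    Finset.card_singleton, one_mul]
  exact Finset.prod_congr rfl fun j hj => by
    rw [dif_neg (Finset.ne_of_mem_erase hj), Finset.card_univ]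

end Counting

/-! ### Construction of the scheme at fixed block length. -/

section Code

/-- The tuple of messages of the three users. -/
def assemble {K : Pair → ℕ} (t : (j : Fin 3) → Sent K j) : Msgs K := fun p => t p.1.1 ⟨p, rfl⟩

theorem DecodesTo.epsilon_eq {W : Type*} [Nonempty W] {D : W → Prop} {A : Set W} {w : W}
    (hd : DecodesTo D A w) (hw : w ∈ A) : Classical.epsilon (fun t => t ∈ A ∧ D t) = w := by
  have h1 := Classical.epsilon_spec (p := fun t => t ∈ A ∧ D t) ⟨w, hw, hd.1⟩
  exact hd.2 _ h1.1 h1.2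

theorem prob_le_of_forall {M : Pair → ℕ} {n : ℕ} {E : Msgs M → Noise n → Prop} {c : Msgs M → ℝ≥0∞}
    (hE : ∀ m, noiseLaw n {z | E m z} ≤ c m) {C : ℝ≥0∞}
    (hc : ∑ m, c m ≤ Fintype.card (Msgs M) * C) : prob E ≤ C := by
  refine ENNReal.div_le_of_le_mul ?_
  rw [mul_comm]
  exact (Finset.sum_le_sum fun m _ => hE m).trans hc

/-- The error bound for decoding all messages at the relay. -/
noncomputable def uplinkBound (h : Fin 3 → ℝ) (ε P : ℝ) (q : ℝ≥0) (K : Pair → ℕ) (ℓ : ℕ) : ℝ≥0∞ :=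
  errorBound ε P q h (fun S => ∏ j ∈ S, Fintype.card (Sent K j)) ℓ

/-- The error bound for decoding the messages of the other users at user `i`. -/
noncomputable def downlinkBound (h : Fin 3 → ℝ) (ε P : ℝ) (q : ℝ≥0) (K : Pair → ℕ) (ℓ : ℕ)
    (i : Fin 3) : ℝ≥0∞ :=
  errorBound ε P q (fun _ : Unit => h i)
    (fun _ => ∏ j ∈ Finset.univ.erase i, Fintype.card (Sent K j)) ℓ

theorem exists_uplink_codebook {h : Fin 3 → ℝ} (hh : ∀ j, h j ≠ 0) (K : Pair → ℕ) {Θ : Type*}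
    [Fintype Θ] (w : Θ → (j : Fin 3) → Sent K j) {ε P : ℝ} (hε : 0 < ε) (hε1 : ε < 1) {q : ℝ≥0}
    (hq : q ≠ 0) (hqP : (q : ℝ) < P) (ℓ : ℕ) :
    ∃ (x : (j : Fin 3) → Sent K j → Fin ℓ → ℝ) (D : (Fin ℓ → ℝ) → ((j : Fin 3) → Sent K j) → Prop),
      (∀ j v, ∑ k, x j v k ^ 2 ≤ ℓ * P) ∧ Measurable D ∧
      ∑ θ, blockNoise ℓ {ζ | ¬ DecodesTo (D fun k => ∑ j, h j * x j (w θ j) k + ζ k)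
        Set.univ (w θ)} ≤ Fintype.card Θ * uplinkBound h ε P q K ℓ := by
  classical
  obtain ⟨x, D, hx, hD, hs⟩ := exists_codebook (R := Unit) (g := fun _ => h) (fun _ => hh)
    (fun _ _ => Set.univ) (fun _ S => ∏ j ∈ S, Fintype.card (Sent K j))
    (fun _ w S _ => by convert card_diffSet_eq_le w _ S) w hε hε1 hq hqP ℓ
  refine ⟨x, D (), hx, hD (), ?_⟩
  simpa [uplinkBound] using hs

theorem exists_downlink_codebook {h : Fin 3 → ℝ} (hh : ∀ j, h j ≠ 0) (K : Pair → ℕ) {Θ : Type*}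
    [Fintype Θ] (w : Θ → (j : Fin 3) → Sent K j) {ε P : ℝ} (hε : 0 < ε) (hε1 : ε < 1) {q : ℝ≥0}
    (hq : q ≠ 0) (hqP : (q : ℝ) < P) (ℓ : ℕ) :
    ∃ (x : ((j : Fin 3) → Sent K j) → Fin ℓ → ℝ)
      (D : Fin 3 → (Fin ℓ → ℝ) → ((j : Fin 3) → Sent K j) → Prop),
      (∀ t, ∑ k, x t k ^ 2 ≤ ℓ * P) ∧ (∀ i, Measurable (D i)) ∧
      ∑ θ, ∑ i, blockNoise ℓ {ζ | ¬ DecodesTo (D i fun k => h i * x (w θ) k + ζ k)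
        {t | t i = w θ i} (w θ)} ≤ Fintype.card Θ * ∑ i, downlinkBound h ε P q K ℓ i := by
  classical
  obtain ⟨x, D, hx, hD, hs⟩ := exists_codebook (ι := Unit) (V := fun _ => (j : Fin 3) → Sent K j)
    (g := fun i _ => h i) (fun i _ => hh i)
    (fun i w => {t | t () i = w () i})
    (fun i _ => ∏ j ∈ Finset.univ.erase i, Fintype.card (Sent K j))
    (fun i w S _ => by
      convert card_agree_le i (w () i)
        (fun w' => w' () i = w () i ∧ diffSet w w' = S) fun w' hw' => hw'.1
      rfl)
    (fun θ _ => w θ) hε hε1 hq hqP ℓ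
  refine ⟨x (), fun i y t => D i y fun _ => t, hx (), fun i => measurable_pi_iff.2 fun t =>
    (measurable_pi_iff.1 (hD i)) _, le_trans ?_ hs⟩
  refine Finset.sum_le_sum fun θ _ => Finset.sum_le_sum fun i _ => measure_mono fun ζ hζ hd => hζ ?_
  simp only [Finset.univ_unique, Finset.sum_singleton] at hd
  exact ⟨hd.1, fun t ht hDt => congrFun (hd.2 (fun _ => t) ht hDt) ()⟩

/-- The same codebooks serve all `B` blocks, and a union bound over the blocks replaces any
independence between them. Injective splitting need not make submessages uniform, so the codebooks
are chosen for the average over the pairs (message tuple, block) that actually occur. -/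
theorem exists_cdfCode {h : Fin 3 → ℝ} (hh : ∀ j, h j ≠ 0) {M K : Pair → ℕ} {n ℓ B : ℕ}
    (hℓ : 0 < ℓ) (hfit : (B + 1) * ℓ ≤ n) (hM : ∀ p, 0 < M p) (hK : ∀ p, 0 < K p)
    (hMK : ∀ p, M p ≤ K p ^ B) {ε P : ℝ} (hε : 0 < ε) (hε1 : ε < 1) {q : ℝ≥0} (hq : q ≠ 0)
    (hqP : (q : ℝ) < P) :
    ∃ s : CDFCode M n, PowerConstraint h P s.toCode ∧
      prob (s.RelayError h) ≤ B * uplinkBound h ε P q K ℓ ∧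
      prob (DecodingError h s.toCode)
        ≤ B * (uplinkBound h ε P q K ℓ + ∑ i, downlinkBound h ε P q K ℓ i) := by
  classical
  have hsplit : ∀ p, ∃ f : Fin (M p) → Fin B → Fin (K p), Function.Injective f := fun p => by
    obtain ⟨f⟩ := Function.Embedding.nonempty_of_card_le
      (α := Fin (M p)) (β := Fin B → Fin (K p)) (by simpa using hMK p)
    exact ⟨f, f.injective⟩
  choose split hsplit using hsplit
  have hKne : ∀ j : Fin 3, Nonempty (Sent K j) := fun j => ⟨fun p => ⟨0, hK p.1⟩⟩
  have hMne : ∀ p, Nonempty (Fin (M p)) := fun p => ⟨⟨0, hM p⟩⟩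
  let w : Msgs M × Fin B → (j : Fin 3) → Sent K j := fun θ j =>
    sent (fun p => split p (θ.1 p) θ.2) j
  obtain ⟨x, D, hx, hD, hxD⟩ := exists_uplink_codebook hh K w hε hε1 hq hqP ℓ
  obtain ⟨xr, Dr, hxr, hDr, hxDr⟩ := exists_downlink_codebook hh K w hε hε1 hq hqP ℓ
  have hidx : ∀ (b : Fin B) (k : Fin ℓ), (b + 1 : ℕ) * ℓ + k < n := fun b k => by
    have h1 : ((b : ℕ) + 1 + 1) * ℓ ≤ (B + 1) * ℓ := Nat.mul_le_mul_right _ (by omega)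
    have h2 : ((b : ℕ) + 1 + 1) * ℓ = (b + 1) * ℓ + ℓ := Nat.succ_mul _ _
    have h4 := k.2
    omega
  let relayDec : (Fin ℓ → ℝ) → Msgs K := fun y =>
    assemble (Classical.epsilon fun t => t ∈ Set.univ ∧ D y t)
  -- The search is restricted to tuples consistent with the user's own submessages.
  let blockDec : (i : Fin 3) → (((j : Fin 3) → Sent K j) → Prop) → Sent K i → Msgs K :=
    fun i E v => assemble (Classical.epsilon fun t => t ∈ {t | t i = v} ∧ E t)
  let outer : (i : Fin 3) → Sent M i → (Fin B → ((j : Fin 3) → Sent K j) → Prop) → Wanted M i :=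
    fun i v E p => Function.invFun (split p.1) fun b =>
      blockDec i (E b) (fun p => split p.1 (v p) b) p.1
  let s : CDFCode M n :=
    { ℓ := ℓ
      B := B
      ℓ_pos := hℓ
      fits := hfit
      K := K
      split := split
      split_injective := hsplit
      userBook := x
      relayDec := relayDec
      relayBook := fun m => xr fun j => sent m j
      dec := fun i y v => outer i v fun b => Dr i fun k => y ⟨(b + 1 : ℕ) * ℓ + k, hidx b k⟩
      measurable_relayDec := (measurable_of_finite fun E : ((j : Fin 3) → Sent K j) → Prop =>
        assemble (Classical.epsilon fun t => t ∈ Set.univ ∧ E t)).comp hD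
      measurable_dec := fun i v => (measurable_of_finite (outer i v)).comp
        (measurable_pi_lambda _ fun b => (hDr i).comp (by fun_prop)) }
  let badU : Msgs M → Fin B → Set (Fin ℓ → ℝ) := fun m b =>
    {ζ | ¬ DecodesTo (D fun k => ∑ j, h j * x j (w (m, b) j) k + ζ k) Set.univ (w (m, b))}
  let badD : Msgs M → Fin B → Fin 3 → Set (Fin ℓ → ℝ) := fun m b i =>
    {ζ | ¬ DecodesTo (Dr i fun k => h i * xr (w (m, b)) k + ζ k) {t | t i = w (m, b) i} (w (m, b))}
  have hrelay : ∀ m z b, s.relayNoise z b ∉ badU m b →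
      s.relayDec (s.relayBlock h m z b) = s.sub m b := fun m z b hz => by
    have h1 := (not_not.1 hz).epsilon_eq (Set.mem_univ _)
    have h2 : s.relayBlock h m z b
        = fun k => ∑ j, h j * x j (w (m, b) j) k + s.relayNoise z b k :=
      funext fun k => s.relayBlock_eq h m z b k
    rw [h2]
    exact congrArg assemble h1
  have hRE : ∀ m, noiseLaw n {z | s.RelayError h m z} ≤ ∑ b, blockNoise ℓ (badU m b) := fun m => by
    have hsub : {z | s.RelayError h m z} ⊆ ⋃ b, {z | s.relayNoise z b ∈ badU m b} := by
      rintro z ⟨b, hb⟩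
      exact Set.mem_iUnion.2 ⟨b, by_contra fun hz => hb (hrelay m z b hz)⟩
    exact (measure_mono hsub).trans ((measure_iUnion_fintype_le _ _).trans
      (Finset.sum_le_sum fun b _ => s.noiseLaw_relayNoise_le b _))
  have hDE : ∀ m, noiseLaw n {z | DecodingError h s.toCode m z}
      ≤ ∑ b, blockNoise ℓ (badU m b) + ∑ b, ∑ i, blockNoise ℓ (badD m b i) := fun m => by
    -- When the relay decodes block `b` correctly, the users see the intended relay codeword in the
    -- next block; only their own noise can then cause an error.
    have hsub : {z | DecodingError h s.toCode m z} ⊆ (⋃ b, {z | s.relayNoise z b ∈ badU m b}) ∪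
        ⋃ b, ⋃ i, {z | s.userNoise z i b ∈ badD m b i} := by
      rintro z ⟨i, hi⟩
      by_contra hcon
      simp only [Set.mem_union, Set.mem_iUnion, not_or, not_exists] at hcon
      refine hi (funext fun p => ?_)
      have h1 : ∀ b : Fin B, blockDec i (Dr i fun k =>
          (received h s.toCode m z n le_rfl).2 i ⟨(b + 1 : ℕ) * ℓ + k, hidx b k⟩)
          (fun p => split p.1 (sent m i p) b) = fun p => split p (m p) b := fun b => by
        have h2 := (not_not.1 (hcon.2 b i)).epsilon_eq rfl
        have h3 : (fun k : Fin ℓ =>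
            (received h s.toCode m z n le_rfl).2 i ⟨(b + 1 : ℕ) * ℓ + k, hidx b k⟩)
            = fun k => h i * xr (w (m, b)) k + s.userNoise z i b k := funext fun k => by
          refine (s.received_user_block h m z i b k).trans ?_
          rw [hrelay m z b (hcon.1 b)]
          rfl
        rw [h3]
        exact congrArg assemble h2
      have h4 : s.toCode.dec i ((received h s.toCode m z n le_rfl).2 i) (sent m i) p
          = Function.invFun (split p.1) (split p.1 (m p.1)) := by
        refine congrArg (Function.invFun (split p.1)) (funext fun b => ?_)
        exact congrFun (h1 b) p.1
      rw [h4]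
      exact Function.leftInverse_invFun (hsplit p.1) _
    refine (measure_mono hsub).trans ((measure_union_le _ _).trans (add_le_add ?_ ?_))
    · exact (measure_iUnion_fintype_le _ _).trans
        (Finset.sum_le_sum fun b _ => s.noiseLaw_relayNoise_le b _)
    · exact (measure_iUnion_fintype_le _ _).trans (Finset.sum_le_sum fun b _ =>
        (measure_iUnion_fintype_le _ _).trans (Finset.sum_le_sum fun i _ =>
          s.noiseLaw_userNoise_le i b _))
  rw [Fintype.card_prod, Fintype.card_fin, Fintype.sum_prod_type, Nat.cast_mul, mul_assoc]
    at hxD hxDr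
  refine ⟨s, s.powerConstraint h (q.2.trans hqP.le) hx fun _ => hxr _, prob_le_of_forall hRE hxD,
    prob_le_of_forall hDE ?_⟩
  rw [Finset.sum_add_distrib, mul_add, mul_add]
  exact add_le_add hxD hxDr

end Code

/-! ### Vanishing error inside the rate region. -/

section Asymptotics

theorem tendsto_ofReal_pow_zero {x : ℝ} (hx : x < 1) {L : ℕ → ℕ} (hL : Tendsto L atTop atTop) :
    Tendsto (fun i => ENNReal.ofReal x ^ L i) atTop (𝓝 0) :=
  (ENNReal.tendsto_pow_atTop_nhds_zero_of_lt_one (ENNReal.ofReal_lt_one.2 hx)).comp hL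

theorem tendsto_errorBound_zero {ι : Type*} [Fintype ι] {ε P : ℝ} {q : ℝ≥0} {g : ι → ℝ}
    (hε : 0 < ε) (hq : q ≠ 0) (hqP : (q : ℝ) < P) {L : ℕ → ℕ} (hL : Tendsto L atTop atTop)
    {N : ℕ → Finset ι → ℕ} {C κ : Finset ι → ℝ} (hκ : ∀ S, 0 ≤ κ S) (hC : ∀ S, 0 ≤ C S)
    (hN : ∀ i S, S.Nonempty → (N i S : ℝ) ≤ C S * κ S ^ L i)
    (hlt : ∀ S, S.Nonempty → κ S * (Real.exp ε * (√(1 + (∑ j ∈ S, g j ^ 2) * q))⁻¹) < 1) :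
    Tendsto (fun i => errorBound ε P q g (N i) (L i)) atTop (𝓝 0) := by
  have hq0 : (0 : ℝ) < q := by positivity
  have hch : ∀ a, a ≠ 1 → Tendsto (fun i => ENNReal.ofReal (chernoffBase a) ^ L i) atTop (𝓝 0) :=
    fun a ha => tendsto_ofReal_pow_zero (chernoffBase_lt_one ha) hL
  have h1 : Tendsto (fun i => (Fintype.card ι : ℝ≥0∞) *
      ENNReal.ofReal (chernoffBase (P / q)) ^ L i) atTop (𝓝 0) := by
    have := ENNReal.Tendsto.const_mul (a := (Fintype.card ι : ℝ≥0∞))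
      (hch (P / q) ((one_lt_div hq0).2 hqP).ne') (Or.inr (ENNReal.natCast_ne_top _))
    rwa [mul_zero] at this
  have h2 : ∀ S : Finset ι, S.Nonempty → Tendsto (fun i => (N i S : ℝ≥0∞) *
      ENNReal.ofReal (Real.exp ε * (√(1 + (∑ j ∈ S, g j ^ 2) * q))⁻¹) ^ L i) atTop (𝓝 0) :=
    fun S hS => by
    set b := Real.exp ε * (√(1 + (∑ j ∈ S, g j ^ 2) * q))⁻¹
    have hb : 0 ≤ b := by positivity
    have hlt' : κ S * b < 1 := hlt S hS
    have h3 := ENNReal.Tendsto.const_mul (a := ENNReal.ofReal (C S))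
      (tendsto_ofReal_pow_zero hlt' hL) (Or.inr ENNReal.ofReal_ne_top)
    rw [mul_zero] at h3
    refine tendsto_of_tendsto_of_tendsto_of_le_of_le tendsto_const_nhds h3 (fun _ => zero_le)
      fun i => ?_
    simp only
    rw [← ENNReal.ofReal_pow (mul_nonneg (hκ S) hb), ← ENNReal.ofReal_mul (hC S),
      ← ENNReal.ofReal_pow hb, ← ENNReal.ofReal_natCast, ← ENNReal.ofReal_mul (by positivity)]
    refine ENNReal.ofReal_le_ofReal ?_
    rw [mul_pow (κ S) b, ← mul_assoc]
    exact mul_le_mul_of_nonneg_right (hN i S hS) (pow_nonneg hb _)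
  have h4 := tendsto_finsetSum (Finset.univ.filter fun S : Finset ι => S.Nonempty)
    fun S hS => (hch (1 - ε) (by linarith)).add (h2 S (Finset.mem_filter.1 hS).2)
  have h5 := h1.add ((hch (1 + ε) (by linarith)).add h4)
  simpa [errorBound] using h5

/-- At `B⁻¹ = 0` the expression is `2 ^ ρ / √(1 + τ P)`, which is less than `1` exactly when `ρ <
gaussC (τ * P)`; continuity does the rest. -/
theorem eventually_rate_lt {ρ τ P : ℝ} (hτ : 0 ≤ τ) (hP : 0 < P) (hρ : ρ < gaussC (τ * P)) :
    ∀ᶠ B : ℕ in atTop, (2 : ℝ) ^ (ρ * (1 + (B : ℝ)⁻¹)) *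
      (Real.exp (B : ℝ)⁻¹ * (√(1 + τ * (P * (1 - (B : ℝ)⁻¹))))⁻¹) < 1 := by
  have h1 : 0 < 1 + τ * P := by positivity
  have h0 : Tendsto (fun B : ℕ => (B : ℝ)⁻¹) atTop (𝓝 0) := tendsto_inv_atTop_nhds_zero_nat
  have hf : ContinuousAt (fun δ : ℝ => (2 : ℝ) ^ (ρ * (1 + δ)) *
      (Real.exp δ * (√(1 + τ * (P * (1 - δ))))⁻¹)) 0 := by
    have h2 : ContinuousAt (fun δ : ℝ => (√(1 + τ * (P * (1 - δ))))⁻¹) 0 :=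
      ContinuousAt.inv₀ (by fun_prop) (by simpa using (Real.sqrt_pos.2 h1).ne')
    have h3 : ContinuousAt (fun δ : ℝ => (2 : ℝ) ^ (ρ * (1 + δ))) 0 :=
      ContinuousAt.rpow (by fun_prop) (by fun_prop) (Or.inl two_ne_zero)
    exact h3.mul (Real.continuous_exp.continuousAt.mul h2)
  refine (hf.tendsto.comp h0).eventually_lt_const ?_
  simp only [add_zero, mul_one, Real.exp_zero, sub_zero, one_mul]
  rw [← div_eq_mul_inv, div_lt_one (Real.sqrt_pos.2 h1), Real.lt_sqrt (by positivity),
    ← Real.rpow_mul_natCast two_pos.le]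
  rw [← Real.lt_logb_iff_rpow_lt one_lt_two h1]
  unfold gaussC at hρ
  push_cast
  linarith

/-- A user has two messages, each of rate `r j / 2`; rounding up costs a factor `2` for each, hence
`4`. The at most `B` leftover symbols cost `2 ^ r j`, and the extra block costs the factor `1 + B⁻¹`
in the exponent. -/
theorem card_sent_le {n ℓ B : ℕ} (hB : 0 < B) (hn : n ≤ (B + 1) * ℓ + B) (r : Fin 3 → ℝ≥0)
    (j : Fin 3) :
    (Fintype.card (Sent (fun p => ⌈(2 : ℝ) ^ ((n : ℝ) * (r p.1.1 / 2 : ℝ≥0) / B)⌉₊) j) : ℝ)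
      ≤ 4 * 2 ^ (r j : ℝ) * ((2 : ℝ) ^ ((r j : ℝ) * (1 + (B : ℝ)⁻¹))) ^ ℓ := by
  have hB0 : (0 : ℝ) < B := by positivity
  set x : ℝ := (n : ℝ) * (r j / 2 : ℝ≥0) / B with hx
  have hx0 : 0 ≤ x := by positivity
  have hcard : Fintype.card {p : Pair // p.1.1 = j} = 2 := by fin_cases j <;> decide
  have h1 : Fintype.card (Sent (fun p => ⌈(2 : ℝ) ^ ((n : ℝ) * (r p.1.1 / 2 : ℝ≥0) / B)⌉₊) j)
      = ⌈(2 : ℝ) ^ x⌉₊ ^ 2 := by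
    rw [Fintype.card_pi]
    simp only [Fintype.card_fin]
    rw [Finset.prod_congr rfl fun p _ => by rw [p.2], Finset.prod_const, Finset.card_univ, hcard]
  have h2 : (⌈(2 : ℝ) ^ x⌉₊ : ℝ) ≤ 2 * 2 ^ x := by
    have h3 := Nat.ceil_lt_add_one (show (0 : ℝ) ≤ 2 ^ x by positivity)
    have h4 : (1 : ℝ) ≤ 2 ^ x := Real.one_le_rpow one_le_two hx0
    linarith
  rw [h1, Nat.cast_pow]
  refine (pow_le_pow_left₀ (by positivity) h2 2).trans ?_
  have h5 : (2 : ℝ) * x ≤ r j + (r j * (1 + (B : ℝ)⁻¹)) * ℓ := by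
    have h6 : (n : ℝ) ≤ (B + 1) * ℓ + B := by exact_mod_cast hn
    have h7 : (2 : ℝ) * x = r j * (n / B) := by
      rw [hx]; push_cast; ring
    have h8 : (n : ℝ) / B ≤ 1 + (1 + (B : ℝ)⁻¹) * ℓ := by
      rw [div_le_iff₀ hB0]
      have : (1 + (1 + (B : ℝ)⁻¹) * ℓ) * B = (B + 1) * ℓ + B := by field_simp; ring
      linarith
    rw [h7]
    have := mul_le_mul_of_nonneg_left h8 (r j).2
    simp only [NNReal.val_eq_coe] at this
    linarith
  rw [← Real.rpow_mul_natCast two_pos.le, mul_assoc, ← Real.rpow_add two_pos, mul_pow,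
    ← Real.rpow_mul_natCast two_pos.le]
  have h9 : (2 : ℝ) ^ (x * (2 : ℕ)) ≤ 2 ^ (r j + (r j * (1 + (B : ℝ)⁻¹)) * ℓ) :=
    Real.rpow_le_rpow_of_exponent_le one_le_two (by push_cast; linarith)
  linarith

theorem prod_card_sent_le {n ℓ B : ℕ} (hB : 0 < B) (hn : n ≤ (B + 1) * ℓ + B) (r : Fin 3 → ℝ≥0)
    (S : Finset (Fin 3)) :
    ((∏ j ∈ S, Fintype.card
        (Sent (fun p => ⌈(2 : ℝ) ^ ((n : ℝ) * (r p.1.1 / 2 : ℝ≥0) / B)⌉₊) j) : ℕ) : ℝ)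
      ≤ (∏ j ∈ S, 4 * 2 ^ (r j : ℝ)) *
        ((2 : ℝ) ^ ((∑ j ∈ S, (r j : ℝ)) * (1 + (B : ℝ)⁻¹))) ^ ℓ := by
  rw [Nat.cast_prod, Finset.sum_mul, Real.rpow_sum_of_pos two_pos, ← Finset.prod_pow,
    ← Finset.prod_mul_distrib]
  exact Finset.prod_le_prod (fun _ _ => Nat.cast_nonneg _) fun j _ => card_sent_le hB hn r j

/-- A single large `B` controls every loss: `ε = B⁻¹`, `q = P (1 - B⁻¹)`, and the rate loss from the
extra block. It stays fixed while the block length grows. -/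
theorem cdfAchievable_of_lt {h : Fin 3 → ℝ} (hh : ∀ j, h j ≠ 0) {P : ℝ} (hP : 0 < P)
    {r : Fin 3 → ℝ≥0}
    (hup : ∀ S : Finset (Fin 3), S.Nonempty → ∑ j ∈ S, (r j : ℝ) < gaussC ((∑ j ∈ S, h j ^ 2) * P))
    (hdn : ∀ i, ∑ j ∈ Finset.univ.erase i, (r j : ℝ) < gaussC (h i ^ 2 * P)) :
    CDFAchievable h P fun p => r p.1.1 / 2 := by
  have h1 : ∀ᶠ B : ℕ in atTop, ∀ S : Finset (Fin 3), S.Nonempty →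
      (2 : ℝ) ^ ((∑ j ∈ S, (r j : ℝ)) * (1 + (B : ℝ)⁻¹)) * (Real.exp (B : ℝ)⁻¹ *
        (√(1 + (∑ j ∈ S, h j ^ 2) * (P * (1 - (B : ℝ)⁻¹))))⁻¹) < 1 := by
    refine eventually_all.2 fun S => ?_
    by_cases hS : S.Nonempty
    · filter_upwards [eventually_rate_lt (by positivity) hP (hup S hS)] with B hB _ using hB
    · exact Eventually.of_forall fun B h => absurd h hS
  have h2 : ∀ᶠ B : ℕ in atTop, ∀ i : Fin 3,
      (2 : ℝ) ^ ((∑ j ∈ Finset.univ.erase i, (r j : ℝ)) * (1 + (B : ℝ)⁻¹)) * (Real.exp (B : ℝ)⁻¹ *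
        (√(1 + h i ^ 2 * (P * (1 - (B : ℝ)⁻¹))))⁻¹) < 1 :=
    eventually_all.2 fun i => eventually_rate_lt (by positivity) hP (hdn i)
  obtain ⟨B, hBup, hBdn, hB2⟩ := (h1.and (h2.and (eventually_ge_atTop 2))).exists
  have hB0 : 0 < B := by omega
  have hB1 : (1 : ℝ) < B := by exact_mod_cast hB2
  have hε : (0 : ℝ) < (B : ℝ)⁻¹ := by positivity
  have hε1 : (B : ℝ)⁻¹ < 1 := inv_lt_one_of_one_lt₀ hB1
  obtain ⟨q, hq⟩ : ∃ q : ℝ≥0, (q : ℝ) = P * (1 - (B : ℝ)⁻¹) :=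
    ⟨NNReal.mk _ (mul_nonneg hP.le (by linarith)), rfl⟩
  have hq0 : (q : ℝ) ≠ 0 := by rw [hq]; exact (mul_pos hP (by linarith)).ne'
  have hqne : q ≠ 0 := by exact_mod_cast hq0
  have hqP : (q : ℝ) < P := by rw [hq]; nlinarith
  let R : Pair → ℝ≥0 := fun p => r p.1.1 / 2
  -- Total lengths start at `B + 1`, so that blocks are nonempty.
  let L : ℕ → ℕ := fun i => (B + 1 + i) / (B + 1)
  let K : ℕ → Pair → ℕ := fun i p =>
    ⌈(2 : ℝ) ^ (((B + 1 + i : ℕ) : ℝ) * (r p.1.1 / 2 : ℝ≥0) / B)⌉₊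
  have hLpos : ∀ i, 0 < L i := fun i => Nat.div_pos (by omega) (by omega)
  have hLfit : ∀ i, (B + 1) * L i ≤ B + 1 + i := fun i => Nat.mul_div_le _ _
  have hLub : ∀ i, B + 1 + i ≤ (B + 1) * L i + B := fun i => by
    have h3 := Nat.div_add_mod (B + 1 + i) (B + 1)
    have h4 := Nat.mod_lt (B + 1 + i) (show 0 < B + 1 by omega)
    simp only [L]
    omega
  have hL : Tendsto L atTop atTop := by
    refine (Nat.tendsto_div_const_atTop (by omega)).comp ?_
    exact tendsto_atTop_mono (fun i => Nat.le_add_left i (B + 1)) tendsto_id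
  have hM : ∀ i p, 0 < numMsgs R (B + 1 + i) p := fun i p => Nat.ceil_pos.2 (by positivity)
  have hK : ∀ i p, 0 < K i p := fun i p => Nat.ceil_pos.2 (by positivity)
  have hMK : ∀ i p, numMsgs R (B + 1 + i) p ≤ K i p ^ B := fun i p => by
    refine Nat.ceil_le.2 ?_
    rw [Nat.cast_pow]
    refine le_trans (le_of_eq ?_) (pow_le_pow_left₀ (by positivity) (Nat.le_ceil _) B)
    rw [← Real.rpow_mul_natCast two_pos.le, div_mul_cancel₀ _ (by positivity)]
  have hcode := fun i => exists_cdfCode hh (hLpos i) (hLfit i) (hM i) (hK i) (hMK i) hε hε1 hqne hqP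
  choose s hsP hsR hsD using hcode
  have htU : Tendsto (fun i => uplinkBound h (B : ℝ)⁻¹ P q (K i) (L i)) atTop (𝓝 0) :=
    tendsto_errorBound_zero hε hqne hqP hL (fun S => by positivity)
      (fun S => by positivity) (fun i S _ => prod_card_sent_le hB0 (hLub i) r S)
      (fun S hS => by rw [hq]; exact hBup S hS)
  have htD : ∀ j, Tendsto (fun i => downlinkBound h (B : ℝ)⁻¹ P q (K i) (L i) j) atTop (𝓝 0) :=
    fun j => tendsto_errorBound_zero hε hqne hqP hL
      (C := fun _ => ∏ l ∈ Finset.univ.erase j, 4 * 2 ^ (r l : ℝ))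
      (κ := fun _ => (2 : ℝ) ^ ((∑ l ∈ Finset.univ.erase j, (r l : ℝ)) * (1 + (B : ℝ)⁻¹)))
      (fun S => by positivity) (fun S => by positivity)
      (fun i S _ => prod_card_sent_le hB0 (hLub i) r _)
      (fun S hS => by
        have h3 : S = {()} := by
          obtain ⟨u, hu⟩ := hS
          exact Finset.eq_singleton_iff_unique_mem.2 ⟨hu, fun _ _ => rfl⟩
        rw [hq, h3, Finset.sum_singleton]
        exact hBdn j)
  have hBtop : (B : ℝ≥0∞) ≠ ⊤ := ENNReal.natCast_ne_top B
  refine ⟨B + 1, s, hsP, ?_, ?_⟩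
  · have h3 := ENNReal.Tendsto.const_mul (a := (B : ℝ≥0∞))
      (htU.add (tendsto_finsetSum Finset.univ fun j _ => htD j)) (Or.inr hBtop)
    simp only [Finset.sum_const_zero, add_zero, mul_zero] at h3
    exact tendsto_of_tendsto_of_tendsto_of_le_of_le tendsto_const_nhds h3 (fun _ => zero_le) hsD
  · have h3 := ENNReal.Tendsto.const_mul (a := (B : ℝ≥0∞)) htU (Or.inr hBtop)
    rw [mul_zero] at h3
    exact tendsto_of_tendsto_of_tendsto_of_le_of_le tendsto_const_nhds h3 (fun _ => zero_le) hsR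

end Asymptotics

/-! ### From the rate region to the sum-rate. -/

section SumRates

/-- The code that sends nothing. -/
noncomputable def zeroCode (M : Pair → ℕ) (hM : ∀ p, 0 < M p) (n : ℕ) : Code M n where
  userEnc _ _ _ _ := 0
  relayEnc _ _ := 0
  dec _ _ _ p := ⟨0, hM p.1⟩
  measurable_userEnc _ _ _ := measurable_const
  measurable_relayEnc _ := measurable_const
  measurable_dec _ _ := measurable_const

theorem powerConstraint_zeroCode {M : Pair → ℕ} (hM : ∀ p, 0 < M p) (n : ℕ) (h : Fin 3 → ℝ)
    (P : ℝ) : PowerConstraint h P (zeroCode M hM n) := by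
  simp [PowerConstraint, userInput, relayInput, zeroCode, expect]

/-- Finitely many short lengths are filled with silent codes, which does not affect the limit. -/
theorem CDFAchievable.achievable {h : Fin 3 → ℝ} {P : ℝ} {R : Pair → ℝ≥0}
    (hR : CDFAchievable h P R) : Achievable h P R := by
  obtain ⟨N, s, hsP, hsD, -⟩ := hR
  have hM : ∀ n p, 0 < numMsgs R n p := fun n p => Nat.ceil_pos.2 (by positivity)
  have hex : ∀ n, ∃ c : Code (numMsgs R n) n, PowerConstraint h P c ∧
      ∀ i, n = N + i → prob (DecodingError h c) = prob (DecodingError h (s i).toCode) := fun n => by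
    by_cases hn : N ≤ n
    · obtain ⟨i, rfl⟩ := Nat.exists_eq_add_of_le hn
      refine ⟨(s i).toCode, hsP i, fun i' hi' => ?_⟩
      obtain rfl : i = i' := by omega
      rfl
    · exact ⟨zeroCode _ (hM n) n, powerConstraint_zeroCode _ _ _ _, fun i hi => by omega⟩
  choose c hcP hcD using hex
  refine ⟨c, hcP, (tendsto_add_atTop_iff_nat N).1 (hsD.congr fun i => ?_)⟩
  rw [hcD (i + N) i (add_comm _ _)]

theorem cdfSumRate_le_sumCapacity (h : Fin 3 → ℝ) (P : ℝ) : cdfSumRate h P ≤ sumCapacity h P :=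
  iSup₂_le fun R hR => le_iSup₂_of_le R hR.achievable le_rfl

theorem sum_pair_fst_half (r : Fin 3 → ℝ≥0) :
    ∑ p : Pair, ((r p.1.1 / 2 : ℝ≥0) : ℝ≥0∞) = ENNReal.ofReal (∑ j, (r j : ℝ)) := by
  have h1 : (Finset.univ : Finset Pair) = {⟨(0, 1), by decide⟩, ⟨(0, 2), by decide⟩,
      ⟨(1, 0), by decide⟩, ⟨(1, 2), by decide⟩, ⟨(2, 0), by decide⟩, ⟨(2, 1), by decide⟩} := by
    decide
  have h2 : ∑ p : Pair, (r p.1.1 / 2 : ℝ≥0) = ∑ j, r j := by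
    rw [h1, Fin.sum_univ_three]
    rw [Finset.sum_insert (by decide), Finset.sum_insert (by decide), Finset.sum_insert (by decide),
      Finset.sum_insert (by decide), Finset.sum_insert (by decide), Finset.sum_singleton]
    rw [← NNReal.coe_inj]
    push_cast
    ring
  rw [← ENNReal.ofNNReal_finsetSum, h2, ← NNReal.coe_sum, ENNReal.ofReal_coe_nnreal]

/-- Every sum-rate up to `min ((A₁ + A₂ + A₃) / 2) (2 A₃)` is split among the three users so that
the constraints on the pairs of users and on the third user hold. -/
theorem exists_rates {A₁ A₂ A₃ T : ℝ} (h₁₂ : A₂ ≤ A₁) (h₂₃ : A₃ ≤ A₂) (hT : 0 ≤ T)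
    (hTh : T ≤ 1 / 2 * (A₁ + A₂ + A₃)) (hT3 : T ≤ 2 * A₃) :
    ∃ r₁ r₂ r₃ : ℝ, 0 ≤ r₁ ∧ 0 ≤ r₂ ∧ 0 ≤ r₃ ∧ r₁ + r₂ + r₃ = T ∧ r₂ + r₃ ≤ A₁ ∧ r₁ + r₃ ≤ A₂ ∧
      r₁ + r₂ ≤ A₃ ∧ r₃ ≤ A₃ := by
  -- With total `T`, the bound `r₂ + r₃ ≤ A₁` reads `r₁ ≥ T - A₁`, and similarly for `r₂`; so `l₁`,
  -- `l₂` are the least admissible rates. As `r₃ ≤ A₃` reads `r₁ + r₂ ≥ T - A₃`, the least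
  -- admissible `r₁ + r₂` is `s`. What remains is `s ≤ T` and `s ≤ A₃`; the latter uses `2 T ≤ A₁ +
  -- A₂ + A₃` when both `l₁ = T - A₁` and `l₂ = T - A₂` contribute.
  obtain ⟨l₁, hl₁, hl₁', h1⟩ : ∃ l, 0 ≤ l ∧ T - A₁ ≤ l ∧ (l = 0 ∨ l = T - A₁) :=
    ⟨max 0 (T - A₁), le_max_left _ _, le_max_right _ _, max_choice _ _⟩
  obtain ⟨l₂, hl₂, hl₂', h2⟩ : ∃ l, 0 ≤ l ∧ T - A₂ ≤ l ∧ (l = 0 ∨ l = T - A₂) :=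
    ⟨max 0 (T - A₂), le_max_left _ _, le_max_right _ _, max_choice _ _⟩
  obtain ⟨s, hs, hs', h3⟩ : ∃ s, l₁ + l₂ ≤ s ∧ T - A₃ ≤ s ∧ (s = l₁ + l₂ ∨ s = T - A₃) :=
    ⟨max (l₁ + l₂) (T - A₃), le_max_left _ _, le_max_right _ _, max_choice _ _⟩
  refine ⟨l₁, s - l₁, T - s, hl₁, by linarith, ?_, by ring, by linarith, by linarith, ?_,
    by linarith⟩ <;>
  rcases h1 with h1 | h1 <;> rcases h2 with h2 | h2 <;> rcases h3 with h3 | h3 <;> linarith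

theorem gaussC_le_gaussC {x y : ℝ} (hx : 0 ≤ x) (hxy : x ≤ y) : gaussC x ≤ gaussC y := by
  unfold gaussC
  have := Real.logb_le_logb_of_le one_lt_two (show 0 < 1 + x by linarith)
    (show 1 + x ≤ 1 + y by linarith)
  linarith

theorem ofReal_cdfBound_le_cdfSumRate {h₁ h₂ h₃ : ℝ} (h₂₁ : h₂ ^ 2 ≤ h₁ ^ 2) (h₃₂ : h₃ ^ 2 ≤ h₂ ^ 2)
    {P : ℝ} (hP : 0 ≤ P) :
    ENNReal.ofReal (cdfBound h₁ h₂ h₃ P) ≤ cdfSumRate ![h₁, h₂, h₃] P := by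
  rcases le_or_gt (cdfBound h₁ h₂ h₃ P) 0 with hT | hT
  · rw [ENNReal.ofReal_of_nonpos hT]
    exact zero_le
  set T := cdfBound h₁ h₂ h₃ P with hTdef
  set A₁ := gaussC (min (h₁ ^ 2) (h₂ ^ 2 + h₃ ^ 2) * P) with hA₁
  set A₂ := gaussC (h₂ ^ 2 * P) with hA₂
  set A₃ := gaussC (h₃ ^ 2 * P) with hA₃
  have hTa : T ≤ 1 / 2 * (A₁ + A₂ + A₃) := min_le_left _ _
  have hTb : T ≤ gaussC ((h₁ ^ 2 + h₂ ^ 2 + h₃ ^ 2) * P) :=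
    (min_le_right _ _).trans (min_le_left _ _)
  have hTc : T ≤ 2 * A₃ := (min_le_right _ _).trans (min_le_right _ _)
  have hmin : h₂ ^ 2 ≤ min (h₁ ^ 2) (h₂ ^ 2 + h₃ ^ 2) := le_min h₂₁ (by nlinarith)
  have hmono : ∀ {x y : ℝ}, 0 ≤ x → x ≤ y → gaussC (x * P) ≤ gaussC (y * P) := fun hx hxy =>
    gaussC_le_gaussC (by positivity) (mul_le_mul_of_nonneg_right hxy hP)
  have h12 : A₂ ≤ A₁ := hmono (by positivity) hmin
  have h23 : A₃ ≤ A₂ := hmono (by positivity) h₃₂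
  -- A positive bound excludes the degenerate cases: it forces `P > 0` and nonzero gains.
  have hA₃pos : 0 < A₃ := by linarith
  have hh3 : h₃ ^ 2 * P ≠ 0 := fun h0 => by simp [hA₃, h0, gaussC] at hA₃pos
  have hP0 : 0 < P := hP.lt_of_ne (by rintro rfl; simp at hh3)
  have h3sq : 0 < h₃ ^ 2 := by
    have : h₃ ^ 2 ≠ 0 := left_ne_zero_of_mul hh3
    positivity
  have hh : ∀ j, ![h₁, h₂, h₃] j ≠ 0 := fun j hj => by
    have : ∀ j, ![h₁, h₂, h₃] j ^ 2 ≠ 0 := by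
      intro j
      fin_cases j <;> simp only [Fin.reduceFinMk, Matrix.cons_val, Fin.zero_eta, Fin.isValue,
        Matrix.cons_val_zero, Fin.mk_one, Matrix.cons_val_one] <;> nlinarith
    exact this j (by rw [hj]; norm_num)
  obtain ⟨r₁, r₂, r₃, hr₁, hr₂, hr₃, hsum, h23', h13', h12', h3'⟩ :=
    exists_rates h12 h23 hT.le hTa hTc
  -- Scaling by `t < 1` makes all rate constraints strict; `T` itself is reached as `t` tends to
  -- `1`.
  have hkey : ∀ t ∈ Set.Ioo (0 : ℝ) 1, ENNReal.ofReal (t * T) ≤ cdfSumRate ![h₁, h₂, h₃] P := by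
    rintro t ⟨ht0, ht1⟩
    have hlt : ∀ {x y : ℝ}, 0 < y → x ≤ y → t * x < y := fun {x y} hy hxy => by
      have h1 : t * x ≤ t * y := mul_le_mul_of_nonneg_left hxy ht0.le
      have h2 : t * y < 1 * y := mul_lt_mul_of_pos_right ht1 hy
      linarith
    let r : Fin 3 → ℝ≥0 := ![NNReal.mk (t * r₁) (by positivity), NNReal.mk (t * r₂) (by positivity),
      NNReal.mk (t * r₃) (by positivity)]
    have hr0 : (r 0 : ℝ) = t * r₁ := rfl
    have hr1 : (r 1 : ℝ) = t * r₂ := rfl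
    have hr2 : (r 2 : ℝ) = t * r₃ := rfl
    have hpos : ∀ {x : ℝ}, h₃ ^ 2 ≤ x → A₃ ≤ gaussC (x * P) := fun hx => hmono (by positivity) hx
    have hpos2 : ∀ {x : ℝ}, h₂ ^ 2 ≤ x → A₂ ≤ gaussC (x * P) := fun hx => hmono (by positivity) hx
    have hpos1 : ∀ {x : ℝ}, min (h₁ ^ 2) (h₂ ^ 2 + h₃ ^ 2) ≤ x → A₁ ≤ gaussC (x * P) :=
      fun hx => hmono (by positivity) hx
    have hach : CDFAchievable ![h₁, h₂, h₃] P fun p => r p.1.1 / 2 := by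
      refine cdfAchievable_of_lt hh hP0 (fun S hS => ?_) fun i => ?_
      -- The constraints for pairs and for user 3 come from `exists_rates`, and the full set from
      -- `hTb`. Users 1 and 2 alone are covered by the pairs `{1, 3}` and `{1, 2}`.
      · have hcases : S = {0} ∨ S = {1} ∨ S = {2} ∨ S = {0, 1} ∨ S = {0, 2} ∨ S = {1, 2} ∨
            S = {0, 1, 2} := by
          revert S
          decide
        rcases hcases with rfl | rfl | rfl | rfl | rfl | rfl | rfl
        · have h1 := hpos2 h₂₁
          simp only [Finset.sum_singleton, hr0, Matrix.cons_val_zero]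
          exact hlt (by linarith) (by linarith)
        · have h1 := hpos h₃₂
          simp only [Finset.sum_singleton, hr1, Matrix.cons_val_one, Matrix.cons_val_zero]
          exact hlt (by linarith) (by linarith)
        · have h1 := hpos le_rfl
          simp only [Finset.sum_singleton, hr2, Matrix.cons_val]
          exact hlt (by linarith) (by linarith)
        · have h1 := hpos (x := h₁ ^ 2 + h₂ ^ 2) (by nlinarith)
          rw [Finset.sum_pair (by decide), Finset.sum_pair (by decide)]
          simp only [hr0, hr1, Matrix.cons_val_one, Matrix.cons_val_zero, ← mul_add]
          exact hlt (by linarith) (by linarith)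
        · have h1 := hpos2 (x := h₁ ^ 2 + h₃ ^ 2) (by nlinarith)
          rw [Finset.sum_pair (by decide), Finset.sum_pair (by decide)]
          simp only [hr0, hr2, Matrix.cons_val, Matrix.cons_val_zero, ← mul_add]
          exact hlt (by linarith) (by linarith)
        · have h1 := hpos1 (x := h₂ ^ 2 + h₃ ^ 2) (min_le_right _ _)
          rw [Finset.sum_pair (by decide), Finset.sum_pair (by decide)]
          simp only [hr1, hr2, Matrix.cons_val, Matrix.cons_val_one, Matrix.cons_val_zero,
            ← mul_add]
          exact hlt (by linarith) (by linarith)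
        · have hu : ({0, 1, 2} : Finset (Fin 3)) = Finset.univ := by decide
          rw [hu, Fin.sum_univ_three, Fin.sum_univ_three]
          simp only [hr0, hr1, hr2, Matrix.cons_val, Matrix.cons_val_one, Matrix.cons_val_zero,
            ← mul_add]
          exact hlt (by linarith) (by linarith)
      · have hu : Finset.univ.erase (0 : Fin 3) = {1, 2} ∧ Finset.univ.erase (1 : Fin 3) = {0, 2} ∧
          Finset.univ.erase (2 : Fin 3) = {0, 1} := by decide
        fin_cases i
        · have h1 := hpos1 (x := h₁ ^ 2) (min_le_left _ _)
          simp only [Fin.zero_eta, hu.1]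
          rw [Finset.sum_pair (by decide)]
          simp only [hr1, hr2, Matrix.cons_val_zero, ← mul_add]
          exact hlt (by linarith) (by linarith)
        · simp only [Fin.mk_one, hu.2.1]
          rw [Finset.sum_pair (by decide)]
          simp only [hr0, hr2, Matrix.cons_val_one, Matrix.cons_val_zero, ← mul_add]
          exact hlt (by linarith) (by linarith)
        · simp only [Fin.reduceFinMk, hu.2.2]
          rw [Finset.sum_pair (by decide)]
          simp only [hr0, hr1, Matrix.cons_val, ← mul_add]
          exact hlt (by linarith) (by linarith)
    refine le_iSup₂_of_le _ hach ?_
    rw [sum_pair_fst_half, Fin.sum_univ_three, hr0, hr1, hr2, ← mul_add, ← mul_add, hsum]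
  have hcont : Tendsto (fun t : ℝ => ENNReal.ofReal (t * T)) (𝓝[<] 1) (𝓝 (ENNReal.ofReal T)) := by
    have h1 : ContinuousAt (fun t : ℝ => ENNReal.ofReal (t * T)) 1 :=
      (ENNReal.continuous_ofReal.comp (by fun_prop)).continuousAt
    have h2 := h1.tendsto
    rw [one_mul] at h2
    exact h2.mono_left nhdsWithin_le_nhds
  exact le_of_tendsto hcont (mem_of_superset (Ioo_mem_nhdsLT zero_lt_one) hkey)

end SumRates

/-! ### High-power limit: the three terms of the minimum tend to `3/2`, `1` and `2`. -/

section DegreesOfFreedom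

theorem tendsto_gaussC_div_log {a : ℝ} (ha : 0 < a) :
    Tendsto (fun P : ℝ => gaussC (a * P) / (1 / 2 * Real.logb 2 P)) atTop (𝓝 1) := by
  have h1 : Tendsto (fun P : ℝ => 1 + Real.log (P⁻¹ + a) / Real.log P) atTop (𝓝 (1 + 0)) := by
    refine tendsto_const_nhds.add ?_
    have h2 : Tendsto (fun P : ℝ => Real.log (P⁻¹ + a)) atTop (𝓝 (Real.log (0 + a))) :=
      (tendsto_inv_atTop_zero.add tendsto_const_nhds).log (by linarith)
    exact h2.div_atTop Real.tendsto_log_atTop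
  rw [add_zero] at h1
  refine h1.congr' ?_
  filter_upwards [eventually_gt_atTop 1] with P hP
  have hlog : Real.log P ≠ 0 := (Real.log_pos hP).ne'
  have hP0 : 0 < P := by linarith
  -- Factoring out `P` leaves a logarithm that converges to `log a`.
  have h3 : Real.log (1 + a * P) = Real.log P + Real.log (P⁻¹ + a) := by
    rw [← Real.log_mul hP0.ne' (by positivity)]
    congr 1
    field_simp
  have hlog2 : Real.log 2 ≠ 0 := (Real.log_pos one_lt_two).ne'
  unfold gaussC Real.logb
  rw [h3]
  field_simp

theorem tendsto_cdfBound_div_log {h₁ h₂ h₃ : ℝ} (h₂₁ : h₂ ^ 2 ≤ h₁ ^ 2) (h₃₂ : h₃ ^ 2 ≤ h₂ ^ 2)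
    (hh₃ : h₃ ≠ 0) :
    Tendsto (fun P : ℝ => cdfBound h₁ h₂ h₃ P / (1 / 2 * Real.logb 2 P)) atTop (𝓝 1) := by
  have hp3 : 0 < h₃ ^ 2 := by positivity
  have hp2 : 0 < h₂ ^ 2 := hp3.trans_le h₃₂
  have hp1 : 0 < min (h₁ ^ 2) (h₂ ^ 2 + h₃ ^ 2) := lt_min (hp2.trans_le h₂₁) (by positivity)
  have h1 := (((tendsto_gaussC_div_log hp1).add (tendsto_gaussC_div_log hp2)).add
    (tendsto_gaussC_div_log hp3)).const_mul (1 / 2)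
  have h2 := tendsto_gaussC_div_log (show 0 < h₁ ^ 2 + h₂ ^ 2 + h₃ ^ 2 by positivity)
  have h3 := (tendsto_gaussC_div_log hp3).const_mul 2
  have h4 := h1.min (h2.min h3)
  rw [show min (1 / 2 * ((1 : ℝ) + 1 + 1)) (min 1 (2 * 1)) = 1 by norm_num] at h4
  refine h4.congr' ?_
  filter_upwards [eventually_gt_atTop 1] with P hP
  have hlog : 0 ≤ 1 / 2 * Real.logb 2 P :=
    mul_nonneg (by norm_num) (Real.logb_nonneg one_lt_two hP.le)
  rw [cdfBound, ← min_div_div_right hlog, ← min_div_div_right hlog, ← add_div, ← add_div,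
    mul_div_assoc, mul_div_assoc]

end DegreesOfFreedom

end YChannel

theorem mainTheorem8 (h₁ h₂ h₃ : ℝ) (h₂₁ : h₂ ^ 2 ≤ h₁ ^ 2) (h₃₂ : h₃ ^ 2 ≤ h₂ ^ 2) :
    (∀ P : ℝ, 0 ≤ P →
      ENNReal.ofReal (YChannel.cdfBound h₁ h₂ h₃ P) ≤ YChannel.sumCapacity ![h₁, h₂, h₃] P ∧
      ENNReal.ofReal (YChannel.cdfBound h₁ h₂ h₃ P) ≤ YChannel.cdfSumRate ![h₁, h₂, h₃] P) ∧
    (h₃ ≠ 0 →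
      Tendsto (fun P : ℝ => YChannel.cdfBound h₁ h₂ h₃ P / (1 / 2 * Real.logb 2 P))
        atTop (𝓝 1)) := by
  refine ⟨fun P hP => ?_, fun hh₃ => YChannel.tendsto_cdfBound_div_log h₂₁ h₃₂ hh₃⟩
  have h := YChannel.ofReal_cdfBound_le_cdfSumRate h₂₁ h₃₂ hP
  exact ⟨h.trans (YChannel.cdfSumRate_le_sumCapacity _ _), h⟩
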